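/- For a finite set $P$ of points in the Euclidean plane, call a disk (of positive radius) empty if no point of $P$ lies in its interior, and call two disks disjoint if their interiors are disjoint (so tangent disks are allowed). Let $D(P)$ be the minimum number of pairwise disjoint empty disks such that each point of $P$ lies on the boundary of at least one of the disks, and for $n \ge 0$ let $D(n)$ be the maximum of $D(P)$ over all $n$-element point sets $P$ in the plane. Then $$D(n) \ge \Bigl(\frac12 + \frac1{257}\Bigr) n - O(1) \quad\text{for every } n,$$ that is, there is an absolute constant $C$ such that $D(n) \ge (\frac12 + \frac1{257})n - C$ for every $n$. -/

import Mathlib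

/-- The Euclidean plane. -/
abbrev Plane : Type := EuclideanSpace ℝ (Fin 2)

/-- A disk in the plane, given by its center and its positive radius. -/
structure Disk where
  center : Plane
  radius : ℝ
  radius_pos : 0 < radius

/-- The interior of a disk. -/
def Disk.interior (Q : Disk) : Set Plane := Metric.ball Q.center Q.radius

/-- The bounding circle of a disk. -/
def Disk.boundary (Q : Disk) : Set Plane := Metric.sphere Q.center Q.radius

/-- A disk is empty with respect to `P` if no point of `P` lies in its interior
(points of `P` on its boundary are allowed). -/
def Disk.IsEmpty (Q : Disk) (P : Finset Plane) : Prop := ∀ p ∈ P, p ∉ Q.interior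

/-- A bubble set of disjoint disks for `P`: a finite set of empty disks, pairwise disjoint
in the sense that their interiors are disjoint (tangent disks are allowed), such that every
point of `P` lies on the boundary of some disk of the set. -/
structure IsDisjointBubbleSet (P : Finset Plane) (𝒬 : Finset Disk) : Prop where
  isEmpty : ∀ Q ∈ 𝒬, Q.IsEmpty P
  disjoint : ∀ Q ∈ 𝒬, ∀ Q' ∈ 𝒬, Q ≠ Q' → Disjoint Q.interior Q'.interior
  supports : ∀ p ∈ P, ∃ Q ∈ 𝒬, p ∈ Q.boundary

/-- `D(P)`: the minimum number of pairwise disjoint empty disks such that each point of `P`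
lies on the boundary of some disk. -/
noncomputable def disjointBubbleNumberOf (P : Finset Plane) : ℕ :=
  sInf {k | ∃ 𝒬 : Finset Disk, IsDisjointBubbleSet P 𝒬 ∧ 𝒬.card = k}

/-- `D(n)`: the maximum of `D(P)` over all `n`-element point sets `P` in the plane. -/
noncomputable def disjointBubbleNumber (n : ℕ) : ℕ :=
  sSup {k | ∃ P : Finset Plane, P.card = n ∧ disjointBubbleNumberOf P = k}

/-- Every finite point set has a bubble set of at most as many disjoint disks as points. -/
theorem exists_isDisjointBubbleSet (P : Finset Plane) :
    ∃ 𝒬 : Finset Disk, IsDisjointBubbleSet P 𝒬 ∧ 𝒬.card ≤ P.card := by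
  classical
  obtain ⟨r, hr, hsep⟩ : ∃ r : ℝ, 0 < r ∧ ∀ p ∈ P, ∀ q ∈ P, p ≠ q → 4 * r < dist p q := by
    by_cases h : P.offDiag.Nonempty
    · obtain ⟨a, ha, hmin⟩ := P.offDiag.exists_min_image (fun a => dist a.1 a.2) h
      have hpos : 0 < dist a.1 a.2 := dist_pos.2 (Finset.mem_offDiag.1 ha).2.2
      refine ⟨dist a.1 a.2 / 5, by positivity, fun p hp q hq hpq => ?_⟩
      have := hmin (p, q) (Finset.mem_offDiag.2 ⟨hp, hq, hpq⟩)
      simp only at this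
      linarith
    · refine ⟨1, one_pos, fun p hp q hq hpq => ?_⟩
      exact absurd ⟨(p, q), Finset.mem_offDiag.2 ⟨hp, hq, hpq⟩⟩ h
  obtain ⟨v, hv⟩ : ∃ v : Plane, ‖v‖ = r := ⟨EuclideanSpace.single 0 r, by simp [abs_of_pos hr]⟩
  have hdv : ∀ p : Plane, dist p (p + v) = r := fun p => by simp [hv]
  refine ⟨P.image fun p => ⟨p + v, r, hr⟩, ⟨?_, ?_, ?_⟩, Finset.card_image_le⟩
  · intro Q hQ q hq hmem
    obtain ⟨p, hp, rfl⟩ := Finset.mem_image.1 hQ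
    have h1 : dist q (p + v) < r := hmem
    rcases eq_or_ne p q with rfl | hpq
    · linarith [hdv p]
    · linarith [hsep p hp q hq hpq, dist_triangle_right p q (p + v), hdv p]
  · intro Q hQ Q' hQ' hne
    obtain ⟨p, hp, rfl⟩ := Finset.mem_image.1 hQ
    obtain ⟨q, hq, rfl⟩ := Finset.mem_image.1 hQ'
    have hpq : p ≠ q := by rintro rfl; exact hne rfl
    refine Metric.ball_disjoint_ball ?_
    have h1 : dist (p + v) (q + v) = dist p q := dist_add_right p q v
    show r + r ≤ dist (p + v) (q + v)
    linarith [hsep p hp q hq hpq]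
  · intro p hp
    exact ⟨_, Finset.mem_image_of_mem _ hp, hdv p⟩

/-- The minimum in the definition of `D(P)` is attained. -/
theorem isLeast_disjointBubbleNumberOf (P : Finset Plane) :
    IsLeast {k | ∃ 𝒬 : Finset Disk, IsDisjointBubbleSet P 𝒬 ∧ 𝒬.card = k}
      (disjointBubbleNumberOf P) := by
  obtain ⟨𝒬, h, -⟩ := exists_isDisjointBubbleSet P
  exact ⟨Nat.sInf_mem ⟨_, 𝒬, h, rfl⟩, fun _ hk => Nat.sInf_le hk⟩

/-- The maximum in the definition of `D(n)` is attained. -/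
theorem isGreatest_disjointBubbleNumber (n : ℕ) :
    IsGreatest {k | ∃ P : Finset Plane, P.card = n ∧ disjointBubbleNumberOf P = k}
      (disjointBubbleNumber n) := by
  have hb : BddAbove {k | ∃ P : Finset Plane, P.card = n ∧ disjointBubbleNumberOf P = k} := by
    refine ⟨n, ?_⟩
    rintro _ ⟨P, rfl, rfl⟩
    obtain ⟨𝒬, h, hc⟩ := exists_isDisjointBubbleSet P
    exact ((isLeast_disjointBubbleNumberOf P).2 ⟨𝒬, h, rfl⟩).trans hc
  obtain ⟨P, hP⟩ := Infinite.exists_subset_card_eq Plane n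
  exact ⟨Nat.sSup_mem ⟨_, P, hP, rfl⟩ hb, fun _ hk => le_csSup hb hk⟩

/-- Touch data on a cyclic sequence of `127` points: `O` are the disks touching no point off the
circle, `X` the remaining ones, `T` records the touched points, `side` on which side of the circle
a member of `X` lies. -/
structure CyclicTouchData {ι : Type*} (O X : Finset ι) (T : ι → Finset (ZMod 127))
    (side : ι → Bool) : Prop where
  adjacent : ∀ Q, Q ∈ O ∨ Q ∈ X → ∀ k ∈ T Q, ∀ l ∈ T Q, l = k ∨ l = k + 1 ∨ l = k - 1
  covered : ∀ k, ∃ Q, (Q ∈ O ∨ Q ∈ X) ∧ k ∈ T Q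
  separated : ∀ D ∈ X, ∀ D' ∈ X, side D = side D' → ∀ k ∈ T D, ∀ g : ℤ, |g| ≤ 13 →
    k + g ∈ T D' → D = D'
  pinched : ∀ D ∈ X, ∀ D' ∈ X, side D ≠ side D' → ∀ k ∈ T D, ∀ s : ℤ, s = 1 ∨ s = -1 →
    ∀ g : ℤ, 0 ≤ g → g ≤ 6 → k + (s * g : ℤ) ∈ T D' → ∀ E ∈ O,
    k - s ∈ T E → k - 2 * s ∈ T E → False
  obstructed : ∀ D ∈ X, ∀ k ∈ T D, ∃ s : ℤ, (s = 1 ∨ s = -1) ∧ ∀ E ∈ O, ∀ F ∈ O, E ≠ F →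
    k + s ∈ T E → k + 2 * s ∈ T E → k + 3 * s ∈ T F → k + 4 * s ∈ T F → False

namespace CyclicTouchData

variable {ι : Type*} {O X : Finset ι} {T : ι → Finset (ZMod 127)}
  {side : ι → Bool}

theorem card_le_two (h : CyclicTouchData O X T side) {Q : ι} (hQ : Q ∈ O ∨ Q ∈ X) :
    (T Q).card ≤ 2 := by
  by_contra hc
  obtain ⟨a, ha, b, hb, c, hc, hab, hac, hbc⟩ := Finset.two_lt_card.1 (not_le.1 hc)
  have h1 := h.adjacent Q hQ a ha b hb
  have h2 := h.adjacent Q hQ a ha c hc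
  have h3 := h.adjacent Q hQ b hb c hc
  have e1 : (1 : ZMod 127) ≠ 0 := by decide
  have e2 : (2 : ZMod 127) ≠ 0 := by decide
  have e3 : (3 : ZMod 127) ≠ 0 := by decide
  grind

theorem three_contacts (h : CyclicTouchData O X T side) {D₁ D₂ D₃ : ι} (h₁ : D₁ ∈ X)
    (h₂ : D₂ ∈ X) (h₃ : D₃ ∈ X) (h₁₂ : D₁ ≠ D₂) (h₁₃ : D₁ ≠ D₃) (h₂₃ : D₂ ≠ D₃) {k : ZMod 127}
    {g g' : ℤ} (hk : k ∈ T D₁) (hg : k + g ∈ T D₂) (hg' : k + g' ∈ T D₃) (b : |g| ≤ 13)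
    (b' : |g'| ≤ 13) (bb : |g' - g| ≤ 13) : False := by
  by_cases s₁₂ : side D₁ = side D₂
  · exact h₁₂ (h.separated _ h₁ _ h₂ s₁₂ _ hk g b hg)
  by_cases s₁₃ : side D₁ = side D₃
  · exact h₁₃ (h.separated _ h₁ _ h₃ s₁₃ _ hk g' b' hg')
  have s₂₃ : side D₂ = side D₃ := by
    revert s₁₂ s₁₃; cases side D₁ <;> cases side D₂ <;> cases side D₃ <;> simp
  refine h₂₃ (h.separated _ h₂ _ h₃ s₂₃ _ hg (g' - g) bb ?_)
  convert hg' using 1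
  push_cast; ring

/-- The points touched by members of `X` that touch two points. -/
def doubled (X : Finset ι) (T : ι → Finset (ZMod 127)) : Finset (ZMod 127) :=
  (X.filter fun Q => (T Q).card = 2).biUnion T

/-- The credit of a point: each member of `O` distributes two credits among the points
outside `doubled X T` that it touches. -/
def credit (O X : Finset ι) (T : ι → Finset (ZMod 127)) (k : ZMod 127) : ℕ :=
  ∑ Q ∈ O.filter (fun Q => k ∈ T Q), if (T Q \ doubled X T).card = 1 then 2 else 1

theorem card_doubled_le : (doubled X T).card ≤ 2 * (X.filter fun Q => (T Q).card = 2).card := by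
  rw [doubled, mul_comm]
  exact Finset.card_biUnion_le_card_mul _ _ _ fun Q hQ => (Finset.mem_filter.1 hQ).2.le

theorem sum_credit_le (h : CyclicTouchData O X T side) :
    ∑ k ∈ (doubled X T)ᶜ, credit O X T k ≤ 2 * O.card := by
  unfold credit
  simp_rw [Finset.sum_filter]
  rw [Finset.sum_comm, mul_comm]
  refine Finset.sum_le_card_nsmul _ _ _ fun Q hQ => ?_
  rw [← Finset.sum_filter]
  have e : (doubled X T)ᶜ.filter (fun k => k ∈ T Q) = T Q \ doubled X T := by
    ext k; simp [and_comm]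
  rw [e, Finset.sum_const, smul_eq_mul]
  have := (Finset.card_le_card (Finset.sdiff_subset (s := T Q) (t := doubled X T))).trans
    (h.card_le_two (Or.inl hQ))
  split_ifs <;> omega

theorem credit_pos {k : ZMod 127} (hk : ∃ Q ∈ O, k ∈ T Q) : 1 ≤ credit O X T k := by
  obtain ⟨Q, hQ, hkQ⟩ := hk
  unfold credit
  refine le_trans ?_ (Finset.single_le_sum (fun _ _ => Nat.zero_le _)
    (Finset.mem_filter.2 ⟨hQ, hkQ⟩))
  split_ifs <;> omega

/-- A point with a single credit is matched to a neighbour. -/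
theorem exists_partner (h : CyclicTouchData O X T side) {k : ZMod 127} (hkS : k ∉ doubled X T)
    (hk : ∃ Q ∈ O, k ∈ T Q) (hc : credit O X T k < 2) :
    ∃ Q ∈ O, k ∈ T Q ∧ (k + 1 ∈ T Q ∨ k - 1 ∈ T Q) ∧ ∀ Q' ∈ O, k ∈ T Q' → Q' = Q := by
  classical
  obtain ⟨Q, hQ, hkQ⟩ := hk
  have huniq : ∀ Q' ∈ O, k ∈ T Q' → Q' = Q := by
    intro Q' hQ' hkQ'
    by_contra hne
    have : ({Q, Q'} : Finset ι) ⊆ O.filter (fun Q => k ∈ T Q) := by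
      intro R hR
      rcases Finset.mem_insert.1 hR with rfl | hR
      · exact Finset.mem_filter.2 ⟨hQ, hkQ⟩
      · rw [Finset.mem_singleton] at hR; subst hR; exact Finset.mem_filter.2 ⟨hQ', hkQ'⟩
    have h2 : 2 ≤ (O.filter (fun Q => k ∈ T Q)).card := by
      rw [← Finset.card_pair (Ne.symm hne)]; exact Finset.card_le_card this
    have h3 : (O.filter (fun Q => k ∈ T Q)).card ≤ credit O X T k := by
      unfold credit
      rw [Finset.card_eq_sum_ones]
      exact Finset.sum_le_sum fun R _ => by split_ifs <;> omega
    omega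
  refine ⟨Q, hQ, hkQ, ?_, huniq⟩
  have h1 : (T Q \ doubled X T).card ≠ 1 := by
    intro h1
    have h3 : 2 ≤ credit O X T k := by
      unfold credit
      refine le_trans ?_ (Finset.single_le_sum (fun _ _ => Nat.zero_le _)
        (Finset.mem_filter.2 ⟨hQ, hkQ⟩))
      rw [if_pos h1]
    omega
  have hmem : k ∈ T Q \ doubled X T := Finset.mem_sdiff.2 ⟨hkQ, hkS⟩
  have h4 : 1 < (T Q \ doubled X T).card :=
    lt_of_le_of_ne (Finset.card_pos.2 ⟨k, hmem⟩) (Ne.symm h1)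
  obtain ⟨l, hl, hlk⟩ := Finset.exists_mem_ne h4 k
  have hlQ := (Finset.mem_sdiff.1 hl).1
  rcases h.adjacent Q (Or.inl hQ) k hkQ l hlQ with e | e | e
  · exact absurd e hlk
  · exact Or.inl (e ▸ hlQ)
  · exact Or.inr (e ▸ hlQ)

/-- Some member of `X` other than `D` touches a point at most six steps from `k` in
direction `s`. -/
def Near (X : Finset ι) (T : ι → Finset (ZMod 127)) (D : ι) (k : ZMod 127) (s : ℤ) : Prop :=
  ∃ D' ∈ X, D' ≠ D ∧ ∃ g : ℤ, 0 ≤ g ∧ g ≤ 6 ∧ k + (s * g : ℤ) ∈ T D'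

/-- A point is wasteful if it is touched by `O` and has at least two credits. -/
def Wasteful (O X : Finset ι) (T : ι → Finset (ZMod 127)) (k : ZMod 127) : Prop :=
  k ∉ doubled X T ∧ (∃ Q ∈ O, k ∈ T Q) ∧ 2 ≤ credit O X T k

theorem exists_single_contact (h : CyclicTouchData O X T side) {k : ZMod 127}
    (hkS : k ∉ doubled X T) (hk : ∀ Q ∈ O, k ∉ T Q) : ∃ D ∈ X, T D = {k} := by
  obtain ⟨D, hD, hkD⟩ := h.covered k
  have hDX : D ∈ X := hD.resolve_left fun h' => hk D h' hkD
  refine ⟨D, hDX, ?_⟩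
  have h2 : (T D).card ≠ 2 := fun h2 =>
    hkS (Finset.mem_biUnion.2 ⟨D, Finset.mem_filter.2 ⟨hDX, h2⟩, hkD⟩)
  have h3 := h.card_le_two hD
  have h4 : 0 < (T D).card := Finset.card_pos.2 ⟨k, hkD⟩
  obtain ⟨a, ha⟩ := Finset.card_eq_one.1 (show (T D).card = 1 by omega)
  rw [ha] at hkD ⊢
  rw [Finset.mem_singleton.1 hkD]

/-- A point touched by no member of `X` is touched by `O`. -/
theorem own_of_forall (h : CyclicTouchData O X T side) {l : ZMod 127}
    (hl : ∀ Q ∈ X, l ∉ T Q) : l ∉ doubled X T ∧ ∃ Q ∈ O, l ∈ T Q := by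
  constructor
  · intro hd
    obtain ⟨Q, hQ, hlQ⟩ := Finset.mem_biUnion.1 hd
    exact hl Q (Finset.mem_filter.1 hQ).1 hlQ
  · obtain ⟨Q, hQ, hlQ⟩ := h.covered l
    exact ⟨Q, hQ.resolve_right fun h' => hl Q h' hlQ, hlQ⟩

theorem wasteful_of_near (h : CyclicTouchData O X T side) {k : ZMod 127}
    (hkS : k ∉ doubled X T) (hk : ∀ Q ∈ O, k ∉ T Q) {D : ι} (hD : D ∈ X) (hTD : T D = {k})
    {s : ℤ} (hs : s = 1 ∨ s = -1) (hN : Near X T D k s) : Wasteful O X T (k - s) := by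
  obtain ⟨D', hD', hne, g, hg0, hg6, hgT⟩ := hN
  have hkD : k ∈ T D := by rw [hTD]; exact Finset.mem_singleton_self k
  have abs_le13 : ∀ {x : ℤ}, -13 ≤ x → x ≤ 13 → |x| ≤ 13 := fun h1 h2 => abs_le.2 ⟨h1, h2⟩
  have hsd : side D ≠ side D' := fun e => hne.symm <|
    h.separated D hD D' hD' e k hkD (s * g)
      (by rcases hs with rfl | rfl <;> apply abs_le13 <;> omega) hgT
  have free : ∀ Q ∈ X, k - s ∉ T Q := by
    intro Q hQ hT
    have e1 : (1 : ZMod 127) ≠ 0 := by decide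
    have hQD : D ≠ Q := by
      rintro rfl
      rw [hTD, Finset.mem_singleton] at hT
      rcases hs with rfl | rfl
      · push_cast at hT; exact e1 (by linear_combination -hT)
      · push_cast at hT; exact e1 (by linear_combination hT)
    have hQD' : D' ≠ Q := by
      rintro rfl
      have hcase := h.adjacent D' (Or.inr hD') _ hT _ hgT
      have hg : g = 0 := by
        have hcase' := hcase.imp (fun e => sub_eq_zero.2 e)
          (Or.imp (fun e => sub_eq_zero.2 e) (fun e => sub_eq_zero.2 e))
        interval_cases g
        · rfl
        all_goals
          exfalso
          rcases hs with rfl | rfl <;> push_cast at hcase' <;> ring_nf at hcase' <;>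
            revert hcase' <;> decide
      subst hg
      have hkD' : k ∈ T D' := by simpa using hgT
      have hcard : 2 ≤ (T D').card := by
        have : ({k, k - s} : Finset (ZMod 127)) ⊆ T D' := by
          intro x hx
          rcases Finset.mem_insert.1 hx with rfl | hx
          · exact hkD'
          · rw [Finset.mem_singleton.1 hx]; exact hT
        have hne' : k ≠ k - s := by
          intro e
          rcases hs with rfl | rfl
          · push_cast at e; exact e1 (by linear_combination e)
          · push_cast at e; exact e1 (by linear_combination -e)
        rw [← Finset.card_pair hne']; exact Finset.card_le_card this
      exact hkS (Finset.mem_biUnion.2 ⟨D', Finset.mem_filter.2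
        ⟨hD', le_antisymm (h.card_le_two (Or.inr hD')) hcard⟩, hkD'⟩)
    refine h.three_contacts hD hD' hQ hne.symm hQD hQD' hkD hgT (g' := -s) ?_ ?_ ?_ ?_
    · push_cast; rwa [← sub_eq_add_neg]
    all_goals rcases hs with rfl | rfl <;> apply abs_le13 <;> omega
  obtain ⟨hS, hO⟩ := h.own_of_forall free
  refine ⟨hS, hO, ?_⟩
  by_contra hc
  obtain ⟨E, hE, hkE, hpart, -⟩ := h.exists_partner hS hO (not_le.1 hc)
  have key : k - 2 * s ∈ T E := by
    rcases hs with rfl | rfl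
    · rcases hpart with hp | hp
      · exact absurd (by convert hp using 1; push_cast; ring) (hk E hE)
      · convert hp using 1; push_cast; ring
    · rcases hpart with hp | hp
      · convert hp using 1; push_cast; ring
      · exact absurd (by convert hp using 1; push_cast; ring) (hk E hE)
  exact h.pinched D hD D' hD' hsd k hkD s hs g hg0 hg6 hgT E hE hkE key

theorem wasteful_of_not_near (h : CyclicTouchData O X T side) {k : ZMod 127}
    (hk : ∀ Q ∈ O, k ∉ T Q) {D : ι} (hD : D ∈ X) (hTD : T D = {k})
    (hN₁ : ¬ Near X T D k 1) (hN₂ : ¬ Near X T D k (-1)) :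
    ∃ i : ℤ, |i| ≤ 3 ∧ Wasteful O X T (k + i) := by
  have hkD : k ∈ T D := by rw [hTD]; exact Finset.mem_singleton_self k
  obtain ⟨s, hs, hobs⟩ := h.obstructed D hD k hkD
  have free : ∀ i : ℤ, 1 ≤ i → i ≤ 3 → ∀ Q ∈ X, k + (s * i : ℤ) ∉ T Q := by
    intro i hi1 hi3 Q hQ hT
    have hQD : Q ≠ D := by
      rintro rfl
      rw [hTD, Finset.mem_singleton, add_eq_left] at hT
      interval_cases i <;> rcases hs with rfl | rfl <;> revert hT <;> decide
    rcases hs with rfl | rfl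
    · exact hN₁ ⟨Q, hQ, hQD, i, by omega, by omega, hT⟩
    · exact hN₂ ⟨Q, hQ, hQD, i, by omega, by omega, hT⟩
  by_contra hcon
  push Not at hcon
  have single : ∀ i : ℤ, 1 ≤ i → i ≤ 3 → ∃ Q ∈ O, k + (s * i : ℤ) ∈ T Q ∧
      (k + (s * i : ℤ) + 1 ∈ T Q ∨ k + (s * i : ℤ) - 1 ∈ T Q) ∧
        ∀ Q' ∈ O, k + (s * i : ℤ) ∈ T Q' → Q' = Q := by
    intro i hi1 hi3
    obtain ⟨hS, hO⟩ := h.own_of_forall (free i hi1 hi3)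
    refine h.exists_partner hS hO ?_
    by_contra hc
    exact hcon (s * i) (by rcases hs with rfl | rfl <;> exact abs_le.2 ⟨by omega, by omega⟩)
      ⟨hS, hO, not_lt.1 hc⟩
  obtain ⟨E, hE, hE1, hEp, -⟩ := single 1 le_rfl (by norm_num)
  obtain ⟨E', hE', -, -, hE'u⟩ := single 2 (by norm_num) (by norm_num)
  obtain ⟨F, hF, hF3, hFp, -⟩ := single 3 (by norm_num) le_rfl
  have hE2 : k + (s * 2 : ℤ) ∈ T E := by
    rcases hs with rfl | rfl
    · rcases hEp with hp | hp
      · convert hp using 1; push_cast; ring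
      · exact absurd (by convert hp using 1; push_cast; ring) (hk E hE)
    · rcases hEp with hp | hp
      · exact absurd (by convert hp using 1; push_cast; ring) (hk E hE)
      · convert hp using 1; push_cast; ring
  have hEF : E ≠ F := by
    rintro rfl
    have := h.adjacent E (Or.inl hE) _ hE1 _ hF3
    have := this.imp (fun e => sub_eq_zero.2 e)
      (Or.imp (fun e => sub_eq_zero.2 e) (fun e => sub_eq_zero.2 e))
    rcases hs with rfl | rfl <;> push_cast at this <;> ring_nf at this <;> revert this <;> decide
  have hF2 : k + (s * 2 : ℤ) ∉ T F := fun hc =>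
    hEF ((hE'u E hE hE2).trans (hE'u F hF hc).symm)
  have hF4 : k + (s * 4 : ℤ) ∈ T F := by
    rcases hs with rfl | rfl
    · rcases hFp with hp | hp
      · convert hp using 1; push_cast; ring
      · exact absurd (by convert hp using 1; push_cast; ring) hF2
    · rcases hFp with hp | hp
      · exact absurd (by convert hp using 1; push_cast; ring) hF2
      · convert hp using 1; push_cast; ring
  refine hobs E hE F hF hEF ?_ ?_ ?_ ?_
  · convert hE1 using 1; push_cast; ring
  · convert hE2 using 1; push_cast; ring
  · convert hF3 using 1; push_cast; ring
  · convert hF4 using 1; push_cast; ring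

/-- The position of the wasteful point assigned to a point touched by no member of `O`. -/
def Assigned (X : Finset ι) (T : ι → Finset (ZMod 127)) (D : ι) (k y : ZMod 127) : Prop :=
  (Near X T D k 1 ∧ y = k - 1) ∨ (¬ Near X T D k 1 ∧ Near X T D k (-1) ∧ y = k + 1) ∨
    (¬ Near X T D k 1 ∧ ¬ Near X T D k (-1) ∧ ∃ i : ℤ, |i| ≤ 3 ∧ y = k + i)

theorem exists_assigned (h : CyclicTouchData O X T side) {k : ZMod 127}
    (hkS : k ∉ doubled X T) (hk : ∀ Q ∈ O, k ∉ T Q) :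
    ∃ D ∈ X, T D = {k} ∧ ∃ y, Assigned X T D k y ∧ Wasteful O X T y := by
  obtain ⟨D, hD, hTD⟩ := h.exists_single_contact hkS hk
  refine ⟨D, hD, hTD, ?_⟩
  by_cases h₁ : Near X T D k 1
  · exact ⟨k - 1, Or.inl ⟨h₁, rfl⟩, by
      simpa using h.wasteful_of_near hkS hk hD hTD (Or.inl rfl) h₁⟩
  by_cases h₂ : Near X T D k (-1)
  · exact ⟨k + 1, Or.inr (Or.inl ⟨h₁, h₂, rfl⟩), by
      simpa using h.wasteful_of_near hkS hk hD hTD (Or.inr rfl) h₂⟩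
  · obtain ⟨i, hi, hw⟩ := h.wasteful_of_not_near hk hD hTD h₁ h₂
    exact ⟨k + i, Or.inr (Or.inr ⟨h₁, h₂, i, hi, rfl⟩), hw⟩

theorem intCast_ne_zero_of_lt {h : ℤ} (h₁ : 1 ≤ h) (h₂ : h ≤ 126) : (h : ZMod 127) ≠ 0 := by
  rw [Ne, ZMod.intCast_zmod_eq_zero_iff_dvd]
  intro hd
  exact absurd (Int.le_of_dvd (by omega) hd) (by norm_num; omega)

theorem assigned_ne_of_pos (h : CyclicTouchData O X T side) {k : ZMod 127} {D D' : ι}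
    (hD : D ∈ X) (hD' : D' ∈ X) (hTD : T D = {k}) {g : ℤ} (hg : 1 ≤ g) (hg' : g ≤ 6)
    (hTD' : T D' = {k + g}) {y : ZMod 127} (hy : Assigned X T D k y) :
    ¬ Assigned X T D' (k + g) y := by
  intro hy'
  have hkD : k ∈ T D := by rw [hTD]; exact Finset.mem_singleton_self k
  have hkD' : k + g ∈ T D' := by rw [hTD']; exact Finset.mem_singleton_self _
  have hne : D' ≠ D := by
    rintro rfl
    rw [hTD, Finset.mem_singleton, add_eq_left] at hkD'
    exact intCast_ne_zero_of_lt hg (by omega) hkD'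
  have hN : Near X T D k 1 := ⟨D', hD', hne, g, by omega, hg', by simpa using hkD'⟩
  have hN' : Near X T D' (k + g) (-1) := ⟨D, hD, hne.symm, g, by omega, hg', by simpa using hkD⟩
  have hy1 : y = k - 1 := by
    rcases hy with ⟨-, e⟩ | ⟨h1, -⟩ | ⟨h1, -⟩
    · exact e
    · exact absurd hN h1
    · exact absurd hN h1
  rcases hy' with ⟨⟨D₃, hD₃, hne₃, i, hi0, hi6, hiT⟩, -⟩ | ⟨-, -, e⟩ | ⟨-, h1, -⟩
  · have hiT' : k + ((g + i : ℤ) : ZMod 127) ∈ T D₃ := by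
      convert hiT using 1; push_cast; ring
    refine h.three_contacts hD hD' hD₃ hne.symm ?_ hne₃.symm hkD hkD' hiT' ?_ ?_ ?_
    · rintro rfl
      rw [hTD, Finset.mem_singleton, add_eq_left] at hiT'
      exact intCast_ne_zero_of_lt (by omega) (by omega) hiT'
    all_goals exact abs_le.2 ⟨by omega, by omega⟩
  · refine intCast_ne_zero_of_lt (h := g + 2) (by omega) (by omega) ?_
    push_cast
    linear_combination hy1 - e
  · exact h1 hN'

theorem Assigned.exists_int {D : ι} {k y : ZMod 127} (h : Assigned X T D k y) :
    ∃ i : ℤ, |i| ≤ 3 ∧ y = k + i := by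
  rcases h with ⟨-, e⟩ | ⟨-, -, e⟩ | ⟨-, -, e⟩
  · exact ⟨-1, by norm_num, by rw [e]; push_cast; ring⟩
  · exact ⟨1, by norm_num, by rw [e]; push_cast; ring⟩
  · exact e

theorem assigned_injective (h : CyclicTouchData O X T side) {k k' : ZMod 127} {D D' : ι}
    (hD : D ∈ X) (hD' : D' ∈ X) (hTD : T D = {k}) (hTD' : T D' = {k'}) {y : ZMod 127}
    (hy : Assigned X T D k y) (hy' : Assigned X T D' k' y) : k = k' := by
  obtain ⟨i, hi, ei⟩ := hy.exists_int
  obtain ⟨j, hj, ej⟩ := hy'.exists_int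
  rw [abs_le] at hi hj
  have e : k' = k + ((i - j : ℤ) : ZMod 127) := by push_cast; linear_combination ei - ej
  rcases lt_trichotomy (i - j) 0 with hl | hl | hl
  · have e' : k = k' + ((j - i : ℤ) : ZMod 127) := by push_cast; linear_combination ej - ei
    subst e'
    exact absurd hy (h.assigned_ne_of_pos hD' hD hTD' (by omega) (by omega) hTD hy')
  · rw [hl] at e; simpa using e.symm
  · subst e
    exact absurd hy' (h.assigned_ne_of_pos hD hD' hTD (by omega) (by omega) hTD' hy)

theorem card_add_card_ge (h : CyclicTouchData O X T side) :
    128 ≤ 2 * O.card + 2 * (X.filter fun Q => (T Q).card = 2).card := by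
  classical
  set S : Finset (ZMod 127) := (doubled X T)ᶜ with hS
  have hS' : ∀ {k}, k ∈ S ↔ k ∉ doubled X T := by simp [hS]
  set B : Finset (ZMod 127) := S.filter fun k => ∀ Q ∈ O, k ∉ T Q with hB
  have hex : ∀ k ∈ B, ∃ D ∈ X, T D = {k} ∧ ∃ y, Assigned X T D k y ∧ Wasteful O X T y :=
    fun k hk => h.exists_assigned (hS'.1 (Finset.mem_filter.1 hk).1) (Finset.mem_filter.1 hk).2
  choose! D hDX hTD f hf hw using hex
  have hinj : Set.InjOn f B := fun k hk k' hk' e =>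
    h.assigned_injective (hDX k hk) (hDX k' hk') (hTD k hk) (hTD k' hk') (hf k hk)
      (e ▸ hf k' hk')
  set W : Finset (ZMod 127) := S.filter fun k => Wasteful O X T k with hW
  have hBW : B.card ≤ W.card := Finset.card_le_card_of_injOn f
    (fun k hk => Finset.mem_coe.2 (Finset.mem_filter.2 ⟨hS'.2 (hw k hk).1, hw k hk⟩)) hinj
  have hle : ∑ k ∈ S, (1 + if Wasteful O X T k then 1 else 0) ≤
      ∑ k ∈ S, (credit O X T k + if ∀ Q ∈ O, k ∉ T Q then 1 else 0) := by
    refine Finset.sum_le_sum fun k hk => ?_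
    by_cases hb : ∀ Q ∈ O, k ∉ T Q
    · have : ¬ Wasteful O X T k := fun ⟨_, ⟨Q, hQ, hkQ⟩, _⟩ => hb Q hQ hkQ
      rw [if_pos hb, if_neg this]; omega
    · rw [if_neg hb]
      push Not at hb
      have := credit_pos (X := X) hb
      split_ifs with hwk
      · exact hwk.2.2
      · omega
  rw [Finset.sum_add_distrib, Finset.sum_add_distrib, ← Finset.card_filter, ← Finset.card_filter,
    ← Finset.card_eq_sum_ones, ← hW, ← hB] at hle
  have h1 := h.sum_credit_le
  have h2 := card_doubled_le (X := X) (T := T)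
  have h3 : S.card + (doubled X T).card = 127 := by
    rw [hS, Finset.card_compl_add_card, ZMod.card]
  rw [← hS] at h1
  omega

end CyclicTouchData

open Real in
/-- The angle between consecutive points of the regular `127`-gon. -/
noncomputable def stepAngle : ℝ := 2 * π / 127

/-- The unit vector at angle `x` steps. -/
noncomputable def dir (x : ℝ) : ℂ := Complex.exp ((stepAngle * x : ℝ) * Complex.I)

theorem stepAngle_pos : 0 < stepAngle := by
  unfold stepAngle; positivity

theorem stepAngle_le : stepAngle ≤ 0.0497 := by
  unfold stepAngle; have := Real.pi_lt_d2; linarith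

theorem stepAngle_sq_le : stepAngle ^ 2 ≤ 0.00248 := by
  have := stepAngle_le; have := stepAngle_pos; nlinarith

theorem stepAngle_mul : stepAngle * 127 = 2 * Real.pi := by
  unfold stepAngle; ring

theorem norm_dir (x : ℝ) : ‖dir x‖ = 1 := Complex.norm_exp_ofReal_mul_I _

theorem dir_add (x y : ℝ) : dir (x + y) = dir x * dir y := by
  unfold dir; rw [← Complex.exp_add]; congr 1; push_cast; ring

theorem dir_add_period (x : ℝ) : dir (x + 127) = dir x := by
  rw [dir_add]
  have : dir 127 = 1 := by
    unfold dir; rw [stepAngle_mul]; push_cast; exact Complex.exp_two_pi_mul_I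
  rw [this, mul_one]

theorem normSq_dir_sub (a b x y : ℝ) :
    ‖(a : ℂ) * dir x - b * dir y‖ ^ 2 =
      a ^ 2 + b ^ 2 - 2 * a * b * Real.cos (stepAngle * (x - y)) := by
  rw [← Complex.normSq_eq_norm_sq, Complex.normSq_apply]
  have e : stepAngle * (x - y) = stepAngle * x - stepAngle * y := by ring
  simp only [dir, Complex.sub_re, Complex.sub_im, Complex.mul_re, Complex.mul_im,
    Complex.ofReal_re, Complex.ofReal_im, Complex.exp_ofReal_mul_I_re, Complex.exp_ofReal_mul_I_im,
    zero_mul, sub_zero, add_zero]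
  rw [e, Real.cos_sub]
  have h1 := Real.sin_sq_add_cos_sq (stepAngle * x)
  have h2 := Real.sin_sq_add_cos_sq (stepAngle * y)
  linear_combination a ^ 2 * h1 + b ^ 2 * h2

/-- The disk with center `z` and radius `r` meets the unit circle in the arc
with midpoint `dir c` and half-length `w` steps. -/
structure ArcAt (z : ℂ) (r c w : ℝ) : Prop where
  norm_pos : 0 < ‖z‖
  radius_pos : 0 < r
  eq : z = ‖z‖ * dir c
  nonneg : 0 ≤ w
  le_half : w ≤ 1 / 2
  power : 1 + ‖z‖ ^ 2 - r ^ 2 = 2 * ‖z‖ * Real.cos (stepAngle * w)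

/-- The relative extent of a disk on the inner side of the unit circle. -/
noncomputable def inSize (z : ℂ) (r : ℝ) : ℝ := (r + (1 - (‖z‖ ^ 2 - r ^ 2)) / 2) / ‖z‖

/-- The relative extent of a disk on the outer side of the unit circle. -/
noncomputable def outSize (z : ℂ) (r : ℝ) : ℝ := (r - (1 - (‖z‖ ^ 2 - r ^ 2)) / 2) / ‖z‖

namespace ArcAt

variable {z z' : ℂ} {r r' c c' w w' : ℝ}

theorem inSize_mul_outSize (h : ArcAt z r c w) :
    inSize z r * outSize z r = Real.sin (stepAngle * w) ^ 2 := by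
  have h0 := h.norm_pos
  have h1 := h.power
  have h2 := Real.sin_sq_add_cos_sq (stepAngle * w)
  unfold inSize outSize
  rw [div_mul_div_comm, div_eq_iff (by positivity)]
  linear_combination -‖z‖ ^ 2 * h2 + (-(1 + ‖z‖ ^ 2 - r ^ 2) / 4 -
    ‖z‖ * Real.cos (stepAngle * w) / 2) * h1

theorem abs_le_radius (h : ArcAt z r c w) : |(1 - (‖z‖ ^ 2 - r ^ 2)) / 2| ≤ r := by
  have h0 := h.norm_pos
  have h1 := h.inSize_mul_outSize
  unfold inSize outSize at h1
  rw [div_mul_div_comm, div_eq_iff (by positivity)] at h1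
  refine abs_le_of_sq_le_sq ?_ h.radius_pos.le
  nlinarith [mul_nonneg (sq_nonneg (Real.sin (stepAngle * w))) (mul_pos h0 h0).le]

theorem inSize_nonneg (h : ArcAt z r c w) : 0 ≤ inSize z r := by
  have := (abs_le.1 h.abs_le_radius).1
  exact div_nonneg (by linarith) h.norm_pos.le

theorem outSize_nonneg (h : ArcAt z r c w) : 0 ≤ outSize z r := by
  have := (abs_le.1 h.abs_le_radius).2
  exact div_nonneg (by linarith) h.norm_pos.le

theorem sizes_le (h : ArcAt z r c w) (h' : ArcAt z' r' c' w') (hd : r + r' ≤ dist z z') :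
    inSize z r * inSize z' r' + outSize z r * outSize z' r' ≤
      2 * (Real.cos (stepAngle * w) * Real.cos (stepAngle * w') -
        Real.cos (stepAngle * (c - c'))) := by
  have h0 := h.norm_pos
  have h0' := h'.norm_pos
  have h1 := h.power
  have h1' := h'.power
  have hr := h.radius_pos
  have hr' := h'.radius_pos
  have hsq : (r + r') ^ 2 ≤ ‖z - z'‖ ^ 2 := by
    rw [dist_eq_norm] at hd
    exact pow_le_pow_left₀ (by linarith) hd 2
  have he : ‖z - z'‖ ^ 2 = ‖z‖ ^ 2 + ‖z'‖ ^ 2 -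
      2 * ‖z‖ * ‖z'‖ * Real.cos (stepAngle * (c - c')) := by
    rw [← normSq_dir_sub, ← h.eq, ← h'.eq]
  rw [he] at hsq
  unfold inSize outSize
  rw [div_mul_div_comm, div_mul_div_comm, ← add_div, div_le_iff₀ (by positivity)]
  have e : 2 * ‖z‖ * Real.cos (stepAngle * w) * (2 * ‖z'‖ * Real.cos (stepAngle * w')) =
    (1 + ‖z‖ ^ 2 - r ^ 2) * (1 + ‖z'‖ ^ 2 - r' ^ 2) := by rw [h1, h1']
  linarith

theorem cos_ge (h : ArcAt z r c w) : 0.999 ≤ Real.cos (stepAngle * w) := by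
  have h1 := Real.one_sub_sq_div_two_le_cos (x := stepAngle * w)
  have h2 := stepAngle_sq_le
  have h3 : w ^ 2 ≤ 1 / 4 := by nlinarith [h.nonneg, h.le_half]
  have h4 : (stepAngle * w) ^ 2 ≤ 0.00248 * (1 / 4) := by
    rw [mul_pow]; exact mul_le_mul h2 h3 (sq_nonneg _) (by norm_num)
  linarith

theorem power_ge (h : ArcAt z r c w) : 2 * 0.999 * ‖z‖ ≤ 1 + ‖z‖ ^ 2 - r ^ 2 := by
  rw [h.power]; nlinarith [h.cos_ge, h.norm_pos]

theorem inSize_ge (h : ArcAt z r c w) {e : ℂ} (he : dist e z = r) (hn : ‖e‖ ≤ 1 / 1000) :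
    1.9 ≤ inSize z r := by
  have h0 := h.norm_pos
  have h1 := h.power_ge
  have h2 := (abs_le.1 h.abs_le_radius).2
  have h3 : (‖e‖ - ‖z‖) ^ 2 ≤ r ^ 2 := by
    rw [← he, dist_eq_norm]
    exact sq_le_sq.2 (by rw [abs_norm]; exact abs_norm_sub_norm_le e z)
  unfold inSize
  rw [le_div_iff₀ h0]
  have h4 : ‖e‖ * ‖z‖ ≤ 1 / 1000 * ‖z‖ := by gcongr
  nlinarith [sq_nonneg ‖e‖]

theorem outSize_ge (h : ArcAt z r c w) {e : ℂ} (he : dist e z = r) (hn : 1000 ≤ ‖e‖) :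
    1.9 ≤ outSize z r := by
  have h0 := h.norm_pos
  have h1 := h.power_ge
  have h2 := (abs_le.1 h.abs_le_radius).1
  have h3 : (‖e‖ - ‖z‖) ^ 2 ≤ r ^ 2 := by
    rw [← he, dist_eq_norm]
    exact sq_le_sq.2 (by rw [abs_norm]; exact abs_norm_sub_norm_le e z)
  unfold outSize
  rw [le_div_iff₀ h0]
  have h5 : 100 ≤ ‖z‖ := by
    by_contra hlt
    push Not at hlt
    nlinarith
  linarith

end ArcAt

theorem cos_sub_cos_le {x y : ℝ} (h : |x| ≤ |y|) :
    Real.cos x - Real.cos y ≤ (y ^ 2 - x ^ 2) / 2 := by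
  rw [Real.cos_sub_cos]
  have h1 := Real.abs_sin_le_abs (x := (x + y) / 2)
  have h2 := Real.abs_sin_le_abs (x := (x - y) / 2)
  have h3 : |Real.sin ((x + y) / 2) * Real.sin ((x - y) / 2)| ≤ |(x + y) / 2 * ((x - y) / 2)| := by
    rw [abs_mul, abs_mul]; gcongr
  have h4 : (x + y) / 2 * ((x - y) / 2) ≤ 0 := by
    have := sq_le_sq.2 h; nlinarith
  rw [abs_of_nonpos h4] at h3
  have := (abs_le.1 h3).1
  linarith

theorem two_mul_cos_sub_le (w w' t : ℝ) :
    2 * (Real.cos w * Real.cos w' - Real.cos t) ≤ t ^ 2 := by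
  have h1 := Real.one_sub_sq_div_two_le_cos (x := t)
  have h2 : Real.cos w * Real.cos w' ≤ 1 := by
    refine le_trans (le_abs_self _) ?_
    rw [abs_mul]
    exact mul_le_one₀ (Real.abs_cos_le_one _) (abs_nonneg _) (Real.abs_cos_le_one _)
  linarith

theorem two_mul_cos_sub_le_of_le {w w' t : ℝ} (hw : 0 ≤ w) (hw' : 0 ≤ w') (h : w + w' ≤ |t|) :
    2 * (Real.cos w * Real.cos w' - Real.cos t) ≤ t ^ 2 - w ^ 2 - w' ^ 2 := by
  have h1 : Real.cos (w + w') - Real.cos t ≤ _ :=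
    cos_sub_cos_le (by rw [abs_of_nonneg (by linarith)]; exact h)
  have h2 : Real.cos (w - w') - Real.cos t ≤ _ :=
    cos_sub_cos_le ((abs_le.2 ⟨by linarith, by linarith⟩ : |w - w'| ≤ w + w').trans h)
  rw [Real.cos_add] at h1
  rw [Real.cos_sub] at h2
  nlinarith

namespace ArcAt

variable {z z' : ℂ} {r r' c c' w w' : ℝ}

theorem sizes_le_sq (h : ArcAt z r c w) (h' : ArcAt z' r' c' w') (hd : r + r' ≤ dist z z')
    {d : ℝ} (hc : |c - c'| ≤ d) :
    inSize z r * inSize z' r' ≤ stepAngle ^ 2 * d ^ 2 ∧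
      outSize z r * outSize z' r' ≤ stepAngle ^ 2 * d ^ 2 := by
  have h1 := (h.sizes_le h' hd).trans (two_mul_cos_sub_le _ _ _)
  have h2 : (c - c') ^ 2 ≤ d ^ 2 := by rw [← sq_abs]; exact pow_le_pow_left₀ (abs_nonneg _) hc 2
  rw [mul_pow] at h1
  have h3 := mul_le_mul_of_nonneg_left h2 (sq_nonneg stepAngle)
  have h4 := mul_nonneg h.inSize_nonneg h'.inSize_nonneg
  have h5 := mul_nonneg h.outSize_nonneg h'.outSize_nonneg
  constructor <;> linarith

theorem sizes_le_of_abs_eq (h : ArcAt z r c w) (h' : ArcAt z' r' c' w')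
    (hd : r + r' ≤ dist z z') {d : ℝ} (hc : |c - c'| = d) (hw : w + w' ≤ d) :
    inSize z r * inSize z' r' ≤ stepAngle ^ 2 * (d ^ 2 - w ^ 2 - w' ^ 2) ∧
      outSize z r * outSize z' r' ≤ stepAngle ^ 2 * (d ^ 2 - w ^ 2 - w' ^ 2) := by
  have hp := stepAngle_pos
  have h1 := (h.sizes_le h' hd).trans (two_mul_cos_sub_le_of_le (mul_nonneg hp.le h.nonneg)
    (mul_nonneg hp.le h'.nonneg) (by rw [abs_mul, hc, abs_of_pos hp]; nlinarith))
  have h2 : (stepAngle * (c - c')) ^ 2 = stepAngle ^ 2 * d ^ 2 := by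
    rw [mul_pow, ← sq_abs (c - c'), hc]
  rw [h2] at h1
  have h4 := mul_nonneg h.inSize_nonneg h'.inSize_nonneg
  have h5 := mul_nonneg h.outSize_nonneg h'.outSize_nonneg
  constructor <;> nlinarith

end ArcAt

theorem sin_sq_half_step_ge : 0.2498 * stepAngle ^ 2 ≤ Real.sin (stepAngle * (1 / 2)) ^ 2 := by
  have h0 := stepAngle_pos
  have h1 := stepAngle_le
  have h2 := Real.sin_gt_sub_cube (x := stepAngle * (1 / 2)) (by linarith)
  have h3 : stepAngle * 0.4999 ≤ stepAngle * (1 / 2) - (stepAngle * (1 / 2)) ^ 3 / 6 := by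
    nlinarith [stepAngle_sq_le, mul_pos h0 h0]
  have h4 : stepAngle * 0.4999 ≤ Real.sin (stepAngle * (1 / 2)) := h3.trans h2.le
  have h5 := pow_le_pow_left₀ (by positivity) h4 2
  nlinarith [sq_nonneg stepAngle]

section Obstructions

variable {zD zD' zE zF : ℂ} {rD rD' rE rF cD cD' cE cF w w' : ℝ}

/-- The numerical core of the obstruction: `a` and `b` are extents on the two sides. -/
theorem obstruction_numeric {aD aE aF bE bF d S : ℝ} (hd : 0 < d) (hd' : d ≤ 0.00248)
    (hS : 0.2498 * d ≤ S) (aE0 : 0 ≤ aE) (aF0 : 0 ≤ aF) (bE0 : 0 ≤ bE) (bF0 : 0 ≤ bF)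
    (hD : 1.9 ≤ aD) (hE : aE * bE = S) (hF : aF * bF = S) (hDE : aD * aE ≤ d * 2)
    (hDF : aD * aF ≤ d * 12) (hEF : bE * bF ≤ d * 3.5) : False := by
  have h1 : 1.9 * aE ≤ d * 2 := (mul_le_mul_of_nonneg_right hD aE0).trans hDE
  have h2 : 1.9 * aF ≤ d * 12 := (mul_le_mul_of_nonneg_right hD aF0).trans hDF
  have h3 : (1.9 * aE) * (1.9 * aF) ≤ (d * 2) * (d * 12) :=
    mul_le_mul h1 h2 (by positivity) (by positivity)
  have h4 : (1.9 * aE) * (1.9 * aF) * (bE * bF) ≤ (d * 2) * (d * 12) * (d * 3.5) :=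
    mul_le_mul h3 hEF (by positivity) (by positivity)
  have h5 : (1.9 * aE) * (1.9 * aF) * (bE * bF) = 3.61 * (S * S) := by
    rw [← hE]; nth_rewrite 2 [hE]; rw [← hF]; ring
  have h6 : (0.2498 * d) * (0.2498 * d) ≤ S * S :=
    mul_self_le_mul_self (by positivity) hS
  have h7 : d * d * (3.61 * 0.2498 ^ 2) ≤ d * d * (84 * d) := by nlinarith
  have h8 := le_of_mul_le_mul_left h7 (mul_pos hd hd)
  norm_num at h8 hd'
  linarith

theorem pinch_numeric {aD bD' aE bE d S : ℝ} (hd : 0 < d) (hd' : d ≤ 0.00248)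
    (hS : 0.2498 * d ≤ S) (aE0 : 0 ≤ aE) (bE0 : 0 ≤ bE) (hD : 1.9 ≤ aD) (hD' : 1.9 ≤ bD')
    (hE : aE * bE = S) (hDE : aD * aE ≤ d * 2 ^ 2) (hD'E : bD' * bE ≤ d * 8 ^ 2) : False := by
  have h1 : 1.9 * aE ≤ d * 2 ^ 2 := (mul_le_mul_of_nonneg_right hD aE0).trans hDE
  have h2 : 1.9 * bE ≤ d * 8 ^ 2 := (mul_le_mul_of_nonneg_right hD' bE0).trans hD'E
  have h3 : (1.9 * aE) * (1.9 * bE) ≤ (d * 2 ^ 2) * (d * 8 ^ 2) :=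
    mul_le_mul h1 h2 (by positivity) (by positivity)
  have h7 : d * (3.61 * 0.2498) ≤ d * (256 * d) := by nlinarith
  have h8 := le_of_mul_le_mul_left h7 hd
  norm_num at h8 hd'
  linarith

theorem obstruction (hD : ArcAt zD rD cD w) (hE : ArcAt zE rE cE (1 / 2))
    (hF : ArcAt zF rF cF (1 / 2)) (dDE : rD + rE ≤ dist zD zE) (dDF : rD + rF ≤ dist zD zF)
    (dEF : rE + rF ≤ dist zE zF) (cDE : |cD - cE| = 3 / 2 - w) (cDF : |cD - cF| = 7 / 2 - w)
    (cEF : |cE - cF| = 2) (big : 1.9 ≤ inSize zD rD ∨ 1.9 ≤ outSize zD rD) : False := by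
  have hw := hD.nonneg
  have hw' := hD.le_half
  have hd : 0 < stepAngle ^ 2 := pow_pos stepAngle_pos 2
  have e1 := hD.sizes_le_of_abs_eq hE dDE cDE (by linarith)
  have e2 := hD.sizes_le_of_abs_eq hF dDF cDF (by linarith)
  have e3 := hE.sizes_le_of_abs_eq hF dEF cEF (by norm_num)
  have b1 : stepAngle ^ 2 * ((3 / 2 - w) ^ 2 - w ^ 2 - (1 / 2) ^ 2) ≤ stepAngle ^ 2 * 2 := by
    gcongr; nlinarith
  have b2 : stepAngle ^ 2 * ((7 / 2 - w) ^ 2 - w ^ 2 - (1 / 2) ^ 2) ≤ stepAngle ^ 2 * 12 := by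
    gcongr; nlinarith
  have b3 : stepAngle ^ 2 * ((2 : ℝ) ^ 2 - (1 / 2) ^ 2 - (1 / 2) ^ 2) ≤ stepAngle ^ 2 * 3.5 := by
    gcongr; norm_num
  rcases big with big | big
  · exact obstruction_numeric hd stepAngle_sq_le sin_sq_half_step_ge hE.inSize_nonneg
      hF.inSize_nonneg hE.outSize_nonneg hF.outSize_nonneg big hE.inSize_mul_outSize
      hF.inSize_mul_outSize (e1.1.trans b1) (e2.1.trans b2) (e3.2.trans b3)
  · exact obstruction_numeric hd stepAngle_sq_le sin_sq_half_step_ge hE.outSize_nonneg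
      hF.outSize_nonneg hE.inSize_nonneg hF.inSize_nonneg big
      ((mul_comm _ _).trans hE.inSize_mul_outSize)
      ((mul_comm _ _).trans hF.inSize_mul_outSize) (e1.2.trans b1) (e2.2.trans b2) (e3.1.trans b3)

theorem pinch (hD : ArcAt zD rD cD w) (hD' : ArcAt zD' rD' cD' w') (hE : ArcAt zE rE cE (1 / 2))
    (dDE : rD + rE ≤ dist zD zE) (dD'E : rD' + rE ≤ dist zD' zE) (cDE : |cD - cE| ≤ 2)
    (cD'E : |cD' - cE| ≤ 8)
    (big : (1.9 ≤ inSize zD rD ∧ 1.9 ≤ outSize zD' rD') ∨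
      (1.9 ≤ outSize zD rD ∧ 1.9 ≤ inSize zD' rD')) : False := by
  have hd : 0 < stepAngle ^ 2 := pow_pos stepAngle_pos 2
  have e1 := hD.sizes_le_sq hE dDE cDE
  have e2 := hD'.sizes_le_sq hE dD'E cD'E
  rcases big with ⟨b1, b2⟩ | ⟨b1, b2⟩
  · exact pinch_numeric hd stepAngle_sq_le sin_sq_half_step_ge hE.inSize_nonneg hE.outSize_nonneg
      b1 b2 hE.inSize_mul_outSize e1.1 e2.2
  · exact pinch_numeric hd stepAngle_sq_le sin_sq_half_step_ge hE.outSize_nonneg hE.inSize_nonneg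
      b1 b2 ((mul_comm _ _).trans hE.inSize_mul_outSize) e1.2 e2.1

theorem separation (hD : ArcAt zD rD cD w) (hD' : ArcAt zD' rD' cD' w')
    (d : rD + rD' ≤ dist zD zD') (hc : |cD - cD'| ≤ 14)
    (big : (1.9 ≤ inSize zD rD ∧ 1.9 ≤ inSize zD' rD') ∨
      (1.9 ≤ outSize zD rD ∧ 1.9 ≤ outSize zD' rD')) : False := by
  have e1 := hD.sizes_le_sq hD' d hc
  have e2 := stepAngle_sq_le
  rcases big with ⟨b1, b2⟩ | ⟨b1, b2⟩
  · nlinarith [mul_le_mul b1 b2 (by norm_num) (by linarith), e1.1]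
  · nlinarith [mul_le_mul b1 b2 (by norm_num) (by linarith), e1.2]

end Obstructions

section Touching

variable {z : ℂ} {r : ℝ}

theorem norm_dir_sub_sq {c : ℝ} (hz : z = ‖z‖ * dir c) (x : ℝ) :
    dist (dir x) z ^ 2 = 1 + ‖z‖ ^ 2 - 2 * ‖z‖ * Real.cos (stepAngle * (x - c)) := by
  have := normSq_dir_sub 1 ‖z‖ x c
  rw [← hz] at this
  rw [dist_eq_norm]
  simpa using this

theorem exists_eq_norm_mul_dir (z : ℂ) (x : ℝ) :
    ∃ c, z = ‖z‖ * dir c ∧ |c - x| ≤ 127 / 2 := by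
  have hp := stepAngle_pos
  set ψ := Complex.arg (z / dir x) with hψ
  have hdx : dir x ≠ 0 := norm_ne_zero_iff.1 (by rw [norm_dir]; exact one_ne_zero)
  refine ⟨x + ψ / stepAngle, ?_, ?_⟩
  · have h1 := Complex.norm_mul_exp_arg_mul_I (z / dir x)
    rw [norm_div, norm_dir, div_one, ← hψ, eq_div_iff hdx] at h1
    rw [dir_add, ← h1]
    have : dir (ψ / stepAngle) = Complex.exp (ψ * Complex.I) := by
      unfold dir; rw [mul_div_cancel₀ _ hp.ne']
    rw [this]
    simp only [norm_mul, Complex.norm_real, norm_norm, norm_dir, Complex.norm_exp_ofReal_mul_I,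
      mul_one]
    ring
  · have h1 := Complex.abs_arg_le_pi (z / dir x)
    rw [add_sub_cancel_left, abs_div, abs_of_pos hp, div_le_iff₀ hp]
    have := stepAngle_mul
    linarith

theorem cos_step_lt_cos_step {x y : ℝ} (h : |x| < |y|) (hy : |y| ≤ 127 / 2) :
    Real.cos (stepAngle * y) < Real.cos (stepAngle * x) := by
  have hp := stepAngle_pos
  rw [← Real.cos_abs (stepAngle * y), ← Real.cos_abs (stepAngle * x), abs_mul, abs_mul,
    abs_of_pos hp]
  refine Real.cos_lt_cos_of_nonneg_of_le_pi (by positivity) ?_ (by gcongr)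
  have := stepAngle_mul
  nlinarith

/-- An empty disk touching the point `dir p`. -/
theorem exists_arcAt (hz : z ≠ 0) (hr : 0 < r) {p : ℤ} (hemp : ∀ n : ℤ, r ≤ dist (dir n) z)
    (ht : dist (dir p) z = r) : ∃ c, ArcAt z r c |c - p| := by
  obtain ⟨c, hc, hcp⟩ := exists_eq_norm_mul_dir z p
  have h0 : 0 < ‖z‖ := norm_pos_iff.2 hz
  have e1 := norm_dir_sub_sq hc p
  rw [ht] at e1
  refine ⟨c, h0, hr, hc, abs_nonneg _, ?_, ?_⟩
  · by_contra hlt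
    push Not at hlt
    have key : ∀ n : ℤ, |p + n - c| < |p - c| → False := by
      intro n hn
      have e2 := norm_dir_sub_sq hc (p + n : ℤ)
      have e3 := hemp (p + n)
      have e4 := pow_le_pow_left₀ hr.le e3 2
      have e5 := cos_step_lt_cos_step hn (by rwa [abs_sub_comm])
      push_cast at e2 e4
      rw [e1, e2] at e4
      nlinarith
    rcases le_total 0 (c - p) with h | h
    · rw [abs_of_nonneg h] at hlt hcp
      refine key 1 ?_
      rw [abs_of_nonpos (by linarith : (p : ℝ) - c ≤ 0), abs_lt]
      push_cast; constructor <;> linarith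
    · rw [abs_of_nonpos h] at hlt hcp
      refine key (-1) ?_
      rw [abs_of_nonneg (by linarith : 0 ≤ (p : ℝ) - c), abs_lt]
      push_cast; constructor <;> linarith
  · have : Real.cos (stepAngle * |c - p|) = Real.cos (stepAngle * (p - c)) := by
      rw [← Real.cos_abs (stepAngle * (p - c)), abs_mul, abs_of_pos stepAngle_pos, abs_sub_comm]
    rw [this]; linarith

theorem cos_eq_of_touch {c : ℝ} (hz : 0 < ‖z‖) (hc : z = ‖z‖ * dir c) {x y : ℝ}
    (hx : dist (dir x) z = r) (hy : dist (dir y) z = r) :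
    Real.cos (stepAngle * (x - c)) = Real.cos (stepAngle * (y - c)) := by
  have e1 := norm_dir_sub_sq hc x
  have e2 := norm_dir_sub_sq hc y
  rw [hx] at e1
  rw [hy, e1] at e2
  have : 2 * ‖z‖ * (Real.cos (stepAngle * (x - c)) - Real.cos (stepAngle * (y - c))) = 0 := by
    linarith
  have h2 : (2 * ‖z‖) ≠ 0 := by positivity
  exact sub_eq_zero.1 ((mul_eq_zero.1 this).resolve_left h2)

/-- Two points touched by an empty disk are equal or consecutive. -/
theorem touch_adjacent (hz : z ≠ 0) (hr : 0 < r) {p q : ℤ} (hemp : ∀ n : ℤ, r ≤ dist (dir n) z)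
    (hp : dist (dir p) z = r) (hq : dist (dir q) z = r) :
    ∃ n : ℤ, q = p + 127 * n ∨ q = p + 1 + 127 * n ∨ q = p - 1 + 127 * n := by
  obtain ⟨c, hc⟩ := exists_arcAt hz hr hemp hp
  have hcos := cos_eq_of_touch hc.norm_pos hc.eq hp hq
  obtain ⟨n, hn⟩ := Real.cos_eq_cos_iff.1 hcos
  have hs := stepAngle_pos
  have hmul := stepAngle_mul
  have hc2 := abs_le.1 hc.le_half
  rcases hn with hn | hn
  · have : (q : ℝ) = p + 127 * n := by
      refine mul_left_cancel₀ hs.ne' ?_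
      linear_combination hn - n * hmul
    exact ⟨n, Or.inl (by exact_mod_cast this)⟩
  · have h1 : (q : ℝ) - p - 127 * n = 2 * (c - p) := by
      refine mul_left_cancel₀ hs.ne' ?_
      linear_combination hn - n * hmul
    have h2 : -1 ≤ q - p - 127 * n := by
      have : (-1 : ℝ) ≤ q - p - 127 * n := by rw [h1]; linarith
      exact_mod_cast this
    have h3 : q - p - 127 * n ≤ 1 := by
      have : (q : ℝ) - p - 127 * n ≤ 1 := by rw [h1]; linarith
      exact_mod_cast this
    exact ⟨n, by omega⟩

/-- An empty disk touching two consecutive points. -/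
theorem arcAt_of_touch_two (hz : z ≠ 0) (hr : 0 < r) {p : ℤ} {s : ℤ} (hs : s = 1 ∨ s = -1)
    (hemp : ∀ n : ℤ, r ≤ dist (dir n) z) (hp : dist (dir p) z = r)
    (hq : dist (dir (p + s : ℤ)) z = r) : ArcAt z r (p + s / 2) (1 / 2) := by
  obtain ⟨c, hc⟩ := exists_arcAt hz hr hemp hp
  have hcos := cos_eq_of_touch hc.norm_pos hc.eq hp hq
  have hc2 := abs_le.1 hc.le_half
  have habs : |(p : ℝ) - c| = |((p + s : ℤ) : ℝ) - c| := by
    push_cast at hcos ⊢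
    rcases lt_trichotomy |(p : ℝ) - c| |(p : ℝ) + s - c| with h | h | h
    · refine absurd hcos (cos_step_lt_cos_step h ?_).ne'
      rcases hs with rfl | rfl <;> push_cast <;> refine abs_le.2 ⟨by linarith, by linarith⟩
    · exact h
    · refine absurd hcos (cos_step_lt_cos_step h ?_).ne
      exact abs_le.2 ⟨by linarith, by linarith⟩
  have hcc : c = p + s / 2 := by
    rw [abs_eq_abs] at habs
    rcases hs with rfl | rfl <;> push_cast at habs ⊢ <;> rcases habs with h | h <;> linarith
  have hw : |c - p| = 1 / 2 := by
    rw [hcc]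
    rcases hs with rfl | rfl <;> norm_num
  rwa [hw, hcc] at hc

end Touching

/-- The vertices of the regular `127`-gon on the unit circle. -/
noncomputable def vertex (k : ZMod 127) : ℂ := dir k.val

theorem dir_add_int_mul (x : ℝ) (n : ℤ) : dir (x + 127 * n) = dir x := by
  induction n using Int.induction_on with
  | zero => simp
  | succ i ih =>
    rw [← ih, ← dir_add_period (x + 127 * (i : ℤ))]; congr 1; push_cast; ring
  | pred i ih =>
    rw [← ih, ← dir_add_period]; congr 1; push_cast; ring

theorem vertex_intCast (n : ℤ) : vertex n = dir n := by
  unfold vertex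
  have h1 : ((n : ZMod 127).val : ℤ) = n % 127 := ZMod.val_intCast n
  have h2 := Int.emod_add_mul_ediv n 127
  have h3 : (n : ℝ) = ((n : ZMod 127).val : ℝ) + 127 * ((n / 127 : ℤ) : ℝ) := by
    have h4 : n = ((n : ZMod 127).val : ℤ) + 127 * (n / 127) := by rw [h1]; exact h2.symm
    exact_mod_cast congrArg (Int.cast : ℤ → ℝ) h4
  rw [h3, dir_add_int_mul]

theorem vertex_eq (k : ZMod 127) : vertex k = dir ((k.val : ℤ) : ℝ) := by
  unfold vertex; norm_cast

theorem intCast_val (k : ZMod 127) : (((k.val : ℕ) : ℤ) : ZMod 127) = k := by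
  rw [Int.cast_natCast, ZMod.natCast_zmod_val]

theorem vertex_add (k : ZMod 127) (n : ℤ) : vertex (k + n) = dir ((k.val + n : ℤ) : ℝ) := by
  rw [← vertex_intCast]; push_cast; rw [ZMod.natCast_zmod_val]

theorem norm_vertex (k : ZMod 127) : ‖vertex k‖ = 1 := norm_dir _

theorem vertex_injective : Function.Injective vertex := by
  intro k l h
  rw [vertex_eq, vertex_eq] at h
  unfold dir at h
  obtain ⟨n, hn⟩ := Complex.exp_eq_exp_iff_exists_int.1 h
  have h1 := congrArg Complex.im hn
  simp only [Complex.mul_im, Complex.ofReal_re, Complex.ofReal_im, Complex.I_re, Complex.I_im,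
    Complex.add_im, Complex.mul_re, Complex.intCast_re, Complex.intCast_im, Complex.re_ofNat,
    Complex.im_ofNat, mul_one, mul_zero, zero_mul, add_zero, sub_zero] at h1
  have h2 : (((k.val : ℤ)) : ℝ) = (l.val : ℤ) + 127 * n := by
    refine mul_left_cancel₀ stepAngle_pos.ne' ?_
    linear_combination h1 - n * stepAngle_mul
  have h3 : (k.val : ℤ) = l.val + 127 * n := by exact_mod_cast h2
  have hk := ZMod.val_lt k
  have hl := ZMod.val_lt l
  exact ZMod.val_injective 127 (by omega)

open Classical in
/-- The vertices touched by a disk. -/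
noncomputable def touched (z : ℂ) (r : ℝ) : Finset (ZMod 127) :=
  Finset.univ.filter fun k => dist (vertex k) z = r

theorem mem_touched {z : ℂ} {r : ℝ} {k : ZMod 127} : k ∈ touched z r ↔ dist (vertex k) z = r := by
  simp [touched]

section Circle

variable {ι : Type*} {O X : Finset ι} {z : ι → ℂ} {r : ι → ℝ}

/-- Pairwise disjoint empty disks covering the vertices of the regular `127`-gon; the disks in `X`
touch a point far from the unit circle. -/
structure CircleCover (O X : Finset ι) (z : ι → ℂ) (r : ι → ℝ) : Prop where
  disjoint_sets : Disjoint O X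
  radius_pos : ∀ Q, Q ∈ O ∨ Q ∈ X → 0 < r Q
  separated : ∀ Q, Q ∈ O ∨ Q ∈ X → ∀ Q', Q' ∈ O ∨ Q' ∈ X → Q ≠ Q' →
    r Q + r Q' ≤ dist (z Q) (z Q')
  empty : ∀ Q, Q ∈ O ∨ Q ∈ X → ∀ k, r Q ≤ dist (vertex k) (z Q)
  empty_core : ∃ e : ℂ, ‖e‖ ≤ 1 / 1000 ∧ ∀ Q, Q ∈ O ∨ Q ∈ X → r Q ≤ dist e (z Q)
  covered : ∀ k, ∃ Q, (Q ∈ O ∨ Q ∈ X) ∧ dist (vertex k) (z Q) = r Q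
  contact : ∀ Q ∈ X, ∃ e : ℂ, dist e (z Q) = r Q ∧ (‖e‖ ≤ 1 / 1000 ∨ 1000 ≤ ‖e‖)

namespace CircleCover

theorem empty_dir (h : CircleCover O X z r) {Q : ι} (hQ : Q ∈ O ∨ Q ∈ X) (n : ℤ) :
    r Q ≤ dist (dir n) (z Q) := by
  rw [← vertex_intCast]; exact h.empty Q hQ _

theorem center_ne_zero (h : CircleCover O X z r) {Q : ι} (hQ : Q ∈ O ∨ Q ∈ X) {k : ZMod 127}
    (hk : k ∈ touched (z Q) (r Q)) : z Q ≠ 0 := by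
  intro h0
  obtain ⟨e, he, hemp⟩ := h.empty_core
  have h1 := hemp Q hQ
  rw [mem_touched] at hk
  rw [← hk, h0, dist_zero_right, dist_zero_right, norm_vertex] at h1
  linarith

theorem exists_arc (h : CircleCover O X z r) {Q : ι} (hQ : Q ∈ O ∨ Q ∈ X) {k : ZMod 127} {n : ℤ}
    (hk : k + n ∈ touched (z Q) (r Q)) :
    ∃ c, ArcAt (z Q) (r Q) c |c - (k.val + n : ℤ)| :=
  exists_arcAt (h.center_ne_zero hQ hk) (h.radius_pos Q hQ) (h.empty_dir hQ)
    (by rw [← vertex_add]; exact mem_touched.1 hk)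

theorem arc_of_two (h : CircleCover O X z r) {Q : ι} (hQ : Q ∈ O ∨ Q ∈ X) {k : ZMod 127} {n : ℤ}
    {s : ℤ} (hs : s = 1 ∨ s = -1) (hk : k + n ∈ touched (z Q) (r Q))
    (hk' : k + (n + s : ℤ) ∈ touched (z Q) (r Q)) :
    ArcAt (z Q) (r Q) (k.val + n + s / 2) (1 / 2) := by
  have h1 := arcAt_of_touch_two (p := k.val + n) (h.center_ne_zero hQ hk) (h.radius_pos Q hQ) hs
    (h.empty_dir hQ) (by rw [← vertex_add]; exact mem_touched.1 hk)
    (by rw [add_assoc, ← vertex_add]; exact mem_touched.1 hk')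
  push_cast at h1
  exact h1

/-- Whether a disk touches a point well inside the unit circle. -/
noncomputable def innerSide (z : ι → ℂ) (r : ι → ℝ) (Q : ι) : Bool :=
  open Classical in decide (∃ e : ℂ, dist e (z Q) = r Q ∧ ‖e‖ ≤ 1 / 1000)

theorem innerSide_eq_true {Q : ι} :
    innerSide z r Q = true ↔ ∃ e : ℂ, dist e (z Q) = r Q ∧ ‖e‖ ≤ 1 / 1000 := by
  simp only [innerSide, decide_eq_true_eq]

theorem inSize_ge_of_innerSide {Q : ι} {c w : ℝ} (ha : ArcAt (z Q) (r Q) c w)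
    (hs : innerSide z r Q = true) : 1.9 ≤ inSize (z Q) (r Q) := by
  obtain ⟨e, he, hn⟩ := innerSide_eq_true.1 hs
  exact ha.inSize_ge he hn

theorem outSize_ge_of_not_innerSide (h : CircleCover O X z r) {Q : ι} (hQ : Q ∈ X) {c w : ℝ}
    (ha : ArcAt (z Q) (r Q) c w) (hs : innerSide z r Q = false) :
    1.9 ≤ outSize (z Q) (r Q) := by
  obtain ⟨e, he, hn⟩ := h.contact Q hQ
  refine ha.outSize_ge he (hn.resolve_left fun hn' => ?_)
  rw [innerSide_eq_true.2 ⟨e, he, hn'⟩] at hs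
  cases hs

theorem ne_of_mem (h : CircleCover O X z r) {D E : ι} (hD : D ∈ X) (hE : E ∈ O) : D ≠ E := by
  rintro rfl
  exact Finset.disjoint_left.1 h.disjoint_sets hE hD

theorem cyclicTouchData (h : CircleCover O X z r) :
    CyclicTouchData O X (fun Q => touched (z Q) (r Q)) (innerSide z r) where
  adjacent Q hQ k hk l hl := by
    obtain ⟨n, hn⟩ := touch_adjacent (h.center_ne_zero hQ hk) (h.radius_pos Q hQ) (h.empty_dir hQ)
      (by rw [← vertex_eq]; exact mem_touched.1 hk) (by rw [← vertex_eq]; exact mem_touched.1 hl)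
    have h127 : (127 : ZMod 127) = 0 := by decide
    rw [← intCast_val k, ← intCast_val l]
    rcases hn with hn | hn | hn <;> rw [hn] <;> push_cast <;> rw [h127] <;> simp
  covered k := by
    obtain ⟨Q, hQ, hk⟩ := h.covered k
    exact ⟨Q, hQ, mem_touched.2 hk⟩
  separated D hD D' hD' hs k hk g hg hg' := by
    by_contra hne
    obtain ⟨c, hc⟩ := h.exists_arc (n := 0) (Or.inr hD) (by simpa using hk)
    obtain ⟨c', hc'⟩ := h.exists_arc (Or.inr hD') hg'
    refine separation hc hc' (h.separated D (Or.inr hD) D' (Or.inr hD') hne) ?_ ?_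
    · have h1 := abs_le.1 hc.le_half
      have h2 := abs_le.1 hc'.le_half
      have h3 : |(g : ℝ)| ≤ 13 := by exact_mod_cast hg
      rw [abs_le] at h3 ⊢
      push_cast at h1 h2
      constructor <;> linarith
    · cases hsD : innerSide z r D
      · exact Or.inr ⟨h.outSize_ge_of_not_innerSide hD hc hsD,
          h.outSize_ge_of_not_innerSide hD' hc' (hs ▸ hsD)⟩
      · exact Or.inl ⟨inSize_ge_of_innerSide hc hsD, inSize_ge_of_innerSide hc' (hs ▸ hsD)⟩
  pinched D hD D' hD' hs k hk s hs1 g hg0 hg6 hg' E hE hE1 hE2 := by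
    obtain ⟨c, hc⟩ := h.exists_arc (n := 0) (Or.inr hD) (by simpa using hk)
    obtain ⟨c', hc'⟩ := h.exists_arc (Or.inr hD') hg'
    have hcE := h.arc_of_two (Q := E) (k := k) (n := -s) (s := -s) (Or.inl hE) (by omega)
      (by convert hE1 using 1; push_cast; ring) (by convert hE2 using 1; push_cast; ring)
    have hg0' : (0 : ℝ) ≤ g := by exact_mod_cast hg0
    have hg6' : (g : ℝ) ≤ 6 := by exact_mod_cast hg6
    have h1 := abs_le.1 hc.le_half
    have h2 := abs_le.1 hc'.le_half
    push_cast at h1 h2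
    refine pinch hc hc' hcE (h.separated D (Or.inr hD) E (Or.inl hE) (h.ne_of_mem hD hE))
      (h.separated D' (Or.inr hD') E (Or.inl hE) (h.ne_of_mem hD' hE)) ?_ ?_ ?_
    · rw [abs_le]
      rcases hs1 with rfl | rfl <;> push_cast <;> constructor <;> linarith
    · rw [abs_le]
      rcases hs1 with rfl | rfl <;> push_cast at h2 ⊢ <;> constructor <;> linarith
    · cases hsD : innerSide z r D
      · have hsD' : innerSide z r D' = true := by
          rw [hsD] at hs; cases hx : innerSide z r D' <;> simp_all
        exact Or.inr ⟨h.outSize_ge_of_not_innerSide hD hc hsD, inSize_ge_of_innerSide hc' hsD'⟩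
      · have hsD' : innerSide z r D' = false := by
          rw [hsD] at hs; cases hx : innerSide z r D' <;> simp_all
        exact Or.inl ⟨inSize_ge_of_innerSide hc hsD, h.outSize_ge_of_not_innerSide hD' hc' hsD'⟩
  obstructed D hD k hk := by
    obtain ⟨c, hc⟩ := h.exists_arc (n := 0) (Or.inr hD) (by simpa using hk)
    have hbig : 1.9 ≤ inSize (z D) (r D) ∨ 1.9 ≤ outSize (z D) (r D) := by
      cases hsD : innerSide z r D
      · exact Or.inr (h.outSize_ge_of_not_innerSide hD hc hsD)
      · exact Or.inl (inSize_ge_of_innerSide hc hsD)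
    obtain ⟨s, hs, hcs⟩ : ∃ s : ℤ, (s = 1 ∨ s = -1) ∧
        c - (k.val + 0 : ℤ) = s * |c - (k.val + 0 : ℤ)| := by
      rcases le_total 0 (c - (k.val + 0 : ℤ)) with hle | hle
      · exact ⟨1, Or.inl rfl, by rw [abs_of_nonneg hle]; simp⟩
      · exact ⟨-1, Or.inr rfl, by rw [abs_of_nonpos hle]; simp⟩
    refine ⟨s, hs, fun E hE F hF hEF hE1 hE2 hF1 hF2 => ?_⟩
    have hcE := h.arc_of_two (Q := E) (k := k) (n := s) (s := s) (Or.inl hE) hs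
      hE1 (by convert hE2 using 1; push_cast; ring)
    have hcF := h.arc_of_two (Q := F) (k := k) (n := 3 * s) (s := s) (Or.inl hF) hs
      (by convert hF1 using 1; push_cast; ring) (by convert hF2 using 1; push_cast; ring)
    have h0 := hc.nonneg
    have h1 := hc.le_half
    set w := |c - (k.val + 0 : ℤ)| with hw
    push_cast at hcs hcE hcF
    refine obstruction hc hcE hcF
      (h.separated D (Or.inr hD) E (Or.inl hE) (h.ne_of_mem hD hE))
      (h.separated D (Or.inr hD) F (Or.inl hF) (h.ne_of_mem hD hF))
      (h.separated E (Or.inl hE) F (Or.inl hF) hEF) ?_ ?_ ?_ hbig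
    · rcases hs with rfl | rfl <;> push_cast at hcs ⊢
      · rw [abs_of_nonpos] <;> linarith
      · rw [abs_of_nonneg] <;> linarith
    · rcases hs with rfl | rfl <;> push_cast at hcs ⊢
      · rw [abs_of_nonpos] <;> linarith
      · rw [abs_of_nonneg] <;> linarith
    · rcases hs with rfl | rfl <;> push_cast
      · rw [abs_of_nonpos] <;> linarith
      · rw [abs_of_nonneg] <;> linarith

/-- If a disk touches two vertices, its center lies on a ray through the midpoint of an arc. -/
theorem center_pow_of_card (h : CircleCover O X z r) {Q : ι} (hQ : Q ∈ O ∨ Q ∈ X)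
    (hcard : (touched (z Q) (r Q)).card = 2) : z Q ≠ 0 ∧ z Q ^ 127 = -(‖z Q‖ : ℂ) ^ 127 := by
  obtain ⟨k, l, hkl, hT⟩ := Finset.card_eq_two.1 hcard
  have hk : k ∈ touched (z Q) (r Q) := by rw [hT]; simp
  have hl : l ∈ touched (z Q) (r Q) := by rw [hT]; simp
  obtain ⟨s, hs, e⟩ : ∃ s : ℤ, (s = 1 ∨ s = -1) ∧ l = k + s := by
    rcases h.cyclicTouchData.adjacent Q hQ k hk l hl with e | e | e
    · exact absurd e.symm hkl
    · exact ⟨1, Or.inl rfl, by simpa using e⟩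
    · exact ⟨-1, Or.inr rfl, by rw [e]; push_cast; ring⟩
  have hc := h.arc_of_two (k := k) (n := 0) hQ hs (by simpa using hk) (by simpa [← e] using hl)
  refine ⟨h.center_ne_zero hQ hk, ?_⟩
  obtain ⟨n, hn⟩ : ∃ n : ℤ, (k.val + (0 : ℤ) + s / 2 : ℝ) = n + 1 / 2 := by
    rcases hs with rfl | rfl
    · exact ⟨k.val, by push_cast; ring⟩
    · exact ⟨k.val - 1, by push_cast; ring⟩
  have heq := hc.eq
  rw [hn] at heq
  nth_rewrite 1 [heq]
  rw [mul_pow]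
  have : dir (n + 1 / 2) ^ 127 = -1 := by
    unfold dir
    rw [← Complex.exp_nat_mul]
    have : ((127 : ℕ) : ℂ) * ((stepAngle * (n + 1 / 2) : ℝ) * Complex.I) =
        Real.pi * Complex.I + n * (2 * Real.pi * Complex.I) := by
      have h2 : ((stepAngle : ℂ)) * 127 = 2 * Real.pi := by exact_mod_cast stepAngle_mul
      push_cast
      linear_combination (n + 1 / 2) * Complex.I * h2
    rw [this, Complex.exp_add, Complex.exp_pi_mul_I, Complex.exp_int_mul_two_pi_mul_I, mul_one]
  rw [this, mul_neg_one]

theorem card_ge (h : CircleCover O X z r) :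
    128 ≤ 2 * O.card + 2 * (X.filter fun Q => (touched (z Q) (r Q)).card = 2).card :=
  h.cyclicTouchData.card_add_card_ge

end CircleCover

end Circle

/-- A disk touching both a point well inside and a point well outside the unit circle contains
a vertex. -/
theorem exists_vertex_lt {z : ℂ} {r : ℝ} {e e' : ℂ} (he : dist e z = r)
    (hn : ‖e‖ ≤ 1 / 1000) (he' : dist e' z = r) (hn' : 1000 ≤ ‖e'‖) :
    ∃ k, dist (vertex k) z < r := by
  by_contra hcon
  push Not at hcon
  obtain ⟨c, hc, -⟩ := exists_eq_norm_mul_dir z 0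
  have h1 := norm_dir_sub_sq hc (round c : ℤ)
  have h2 := hcon (round c : ℤ)
  rw [vertex_intCast] at h2
  have hr : 0 ≤ r := by rw [← he]; exact dist_nonneg
  have h3 := pow_le_pow_left₀ hr h2 2
  rw [h1] at h3
  have h4 := abs_sub_round c
  have h5 := Real.one_sub_sq_div_two_le_cos (x := stepAngle * ((round c : ℤ) - c))
  have h6 : (stepAngle * ((round c : ℤ) - c)) ^ 2 ≤ 0.00248 * (1 / 4) := by
    rw [mul_pow]
    refine mul_le_mul stepAngle_sq_le ?_ (sq_nonneg _) (by norm_num)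
    rw [← sq_abs, abs_sub_comm]
    nlinarith [abs_nonneg (c - round c)]
  have key : ∀ x : ℂ, dist x z = r → (‖x‖ - ‖z‖) ^ 2 ≤ r ^ 2 := by
    intro x hx
    rw [← hx, dist_eq_norm]
    exact sq_le_sq.2 (by rw [abs_norm]; exact abs_norm_sub_norm_le x z)
  have h7 := key e he
  have h8 := key e' he'
  have h9 : 0.999 ≤ Real.cos (stepAngle * ((round c : ℤ) - c)) := by linarith
  have h10 := norm_nonneg z
  have h11 : 2 * ‖z‖ * 0.999 ≤ 2 * ‖z‖ * Real.cos (stepAngle * ((round c : ℤ) - c)) := by gcongr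
  have h12 : ‖e‖ * ‖z‖ ≤ 1 / 1000 * ‖z‖ := by gcongr
  have h13 : ‖z‖ ≤ 0.6 := by nlinarith [sq_nonneg ‖e‖]
  nlinarith

/-- Level `0` is a core near the origin, level `j ≥ 1` is the vertex set of a regular `127`-gon
of circumradius `1000 ^ j`. -/
noncomputable def level (K : Finset ℂ) (j : ℕ) : Finset ℂ :=
  if j = 0 then K else Finset.univ.image fun k : ZMod 127 => (-1000 : ℂ) ^ j * vertex k

theorem mem_level_of_pos {K : Finset ℂ} {j : ℕ} (hj : 1 ≤ j) {x : ℂ} :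
    x ∈ level K j ↔ ∃ k, (-1000 : ℂ) ^ j * vertex k = x := by
  rw [level, if_neg (by omega)]; simp

theorem norm_scale (j : ℕ) : ‖(-1000 : ℂ) ^ j‖ = 1000 ^ j := by
  rw [norm_pow, norm_neg]; norm_num

theorem scale_ne_zero (j : ℕ) : (-1000 : ℂ) ^ j ≠ 0 := pow_ne_zero _ (by norm_num)

theorem norm_of_mem_level {K : Finset ℂ} {j : ℕ} (hj : 1 ≤ j) {x : ℂ} (hx : x ∈ level K j) :
    ‖x‖ = 1000 ^ j := by
  obtain ⟨k, rfl⟩ := (mem_level_of_pos hj).1 hx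
  rw [norm_mul, norm_scale, norm_vertex, mul_one]

theorem norm_le_of_mem_level {K : Finset ℂ} (hK : ∀ x ∈ K, ‖x‖ ≤ 1) {j : ℕ} {x : ℂ}
    (hx : x ∈ level K j) : ‖x‖ ≤ 1000 ^ j := by
  rcases Nat.eq_zero_or_pos j with rfl | hj
  · simpa using hK x (by simpa [level] using hx)
  · exact (norm_of_mem_level hj hx).le

theorem card_level {K : Finset ℂ} {j : ℕ} (hj : 1 ≤ j) : (level K j).card = 127 := by
  rw [level, if_neg (by omega), Finset.card_image_of_injective, Finset.card_univ, ZMod.card]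
  exact (mul_right_injective₀ (scale_ne_zero j)).comp vertex_injective

/-- The points of the levels up to `N`. -/
noncomputable def levels (K : Finset ℂ) (N : ℕ) : Finset ℂ :=
  (Finset.range (N + 1)).biUnion (level K)

theorem card_levels {K : Finset ℂ} (hK : ∀ x ∈ K, ‖x‖ ≤ 1) (N : ℕ) :
    (levels K N).card = K.card + 127 * N := by
  have aux : ∀ i j : ℕ, i < j → Disjoint (level K i) (level K j) := by
    intro i j hij
    rw [Finset.disjoint_left]
    intro x hx hx'
    have h1 := norm_le_of_mem_level hK hx
    rw [norm_of_mem_level (by omega) hx'] at h1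
    exact absurd h1 (not_le.2 (pow_lt_pow_right₀ (by norm_num) hij))
  rw [levels, Finset.card_biUnion, Finset.sum_range_succ']
  · rw [Finset.sum_congr rfl fun j _ => card_level (K := K) (Nat.le_add_left 1 j)]
    simp [level]; ring
  · intro i _ j _ hij
    rcases lt_or_gt_of_ne hij with h | h
    · exact aux i j h
    · exact (aux j i h).symm

/-- Disjoint empty disks with centers `C` and radii `r` covering the levels up to `N`. -/
structure LevelsCover {ι : Type*} (K : Finset ℂ) (N : ℕ) (𝒬 : Finset ι) (C : ι → ℂ) (r : ι → ℝ) :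
    Prop where
  core_le : ∀ x ∈ K, ‖x‖ ≤ 1
  core_nonempty : K.Nonempty
  radius_pos : ∀ Q ∈ 𝒬, 0 < r Q
  separated : ∀ Q ∈ 𝒬, ∀ Q' ∈ 𝒬, Q ≠ Q' → r Q + r Q' ≤ dist (C Q) (C Q')
  empty : ∀ Q ∈ 𝒬, ∀ j ≤ N, ∀ x ∈ level K j, r Q ≤ dist x (C Q)
  covered : ∀ j ≤ N, ∀ x ∈ level K j, ∃ Q ∈ 𝒬, dist x (C Q) = r Q

theorem dist_div_scale (x y : ℂ) (j : ℕ) :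
    dist (x / (-1000) ^ j) (y / (-1000) ^ j) = dist x y / 1000 ^ j := by
  rw [dist_eq_norm, dist_eq_norm, ← sub_div, norm_div, norm_scale]

theorem dist_vertex_div_scale (k : ZMod 127) (y : ℂ) (j : ℕ) :
    dist (vertex k) (y / (-1000) ^ j) = dist ((-1000) ^ j * vertex k) y / 1000 ^ j := by
  rw [← dist_div_scale, mul_div_cancel_left₀ _ (scale_ne_zero j)]

namespace LevelsCover

variable {ι : Type*} {K : Finset ℂ} {N : ℕ} {𝒬 : Finset ι} {C : ι → ℂ} {r : ι → ℝ}

/-- The disk `Q` touches a point of level `j`. -/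
def Touches (K : Finset ℂ) (C : ι → ℂ) (r : ι → ℝ) (Q : ι) (j : ℕ) : Prop :=
  ∃ x ∈ level K j, dist x (C Q) = r Q

open Classical in
/-- The disks touching level `j` and no other level up to `N`. -/
noncomputable def own (K : Finset ℂ) (N : ℕ) (𝒬 : Finset ι) (C : ι → ℂ) (r : ι → ℝ) (j : ℕ) :
    Finset ι :=
  𝒬.filter fun Q => Touches K C r Q j ∧ ∀ i ≤ N, Touches K C r Q i → i = j

open Classical in
/-- The disks touching level `j` and some other level up to `N`. -/
noncomputable def contacts (K : Finset ℂ) (N : ℕ) (𝒬 : Finset ι) (C : ι → ℂ) (r : ι → ℝ) (j : ℕ) :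
    Finset ι :=
  𝒬.filter fun Q => Touches K C r Q j ∧ ∃ i ≤ N, Touches K C r Q i ∧ i ≠ j

open Classical in
theorem mem_own {j : ℕ} {Q : ι} : Q ∈ own K N 𝒬 C r j ↔
    Q ∈ 𝒬 ∧ Touches K C r Q j ∧ ∀ i ≤ N, Touches K C r Q i → i = j := by
  rw [own, Finset.mem_filter]

open Classical in
theorem mem_contacts {j : ℕ} {Q : ι} : Q ∈ contacts K N 𝒬 C r j ↔
    Q ∈ 𝒬 ∧ Touches K C r Q j ∧ ∃ i ≤ N, Touches K C r Q i ∧ i ≠ j := by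
  rw [contacts, Finset.mem_filter]

theorem norm_div_scale_le (h : LevelsCover K N 𝒬 C r) {i j : ℕ} (hij : i < j) {x : ℂ}
    (hx : x ∈ level K i) : ‖x / (-1000) ^ j‖ ≤ 1 / 1000 := by
  rw [norm_div, norm_scale, div_le_iff₀ (by positivity)]
  refine (norm_le_of_mem_level h.core_le hx).trans ?_
  obtain ⟨d, rfl⟩ : ∃ d, j = i + 1 + d := ⟨j - (i + 1), by omega⟩
  have : (1 : ℝ) ≤ 1000 ^ d := one_le_pow₀ (by norm_num)
  have h2 : (0 : ℝ) < 1000 ^ i := by positivity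
  rw [pow_add, pow_succ]
  nlinarith

theorem le_norm_div_scale {i j : ℕ} (hij : j < i) {x : ℂ} (hx : x ∈ level K i) :
    1000 ≤ ‖x / (-1000) ^ j‖ := by
  rw [norm_div, norm_scale, le_div_iff₀ (by positivity), norm_of_mem_level (by omega) hx]
  rw [mul_comm, ← pow_succ]
  exact pow_le_pow_right₀ (by norm_num) hij

theorem circleCover (h : LevelsCover K N 𝒬 C r) {j : ℕ} (hj : 1 ≤ j) (hjN : j ≤ N) :
    CircleCover (own K N 𝒬 C r j) (contacts K N 𝒬 C r j) (fun Q => C Q / (-1000) ^ j)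
      (fun Q => r Q / 1000 ^ j) := by
  have hp : (0 : ℝ) < 1000 ^ j := by positivity
  have hmem : ∀ Q, Q ∈ own K N 𝒬 C r j ∨ Q ∈ contacts K N 𝒬 C r j → Q ∈ 𝒬 := by
    rintro Q (hQ | hQ)
    · exact (mem_own.1 hQ).1
    · exact (mem_contacts.1 hQ).1
  refine ⟨?_, ?_, ?_, ?_, ?_, ?_, ?_⟩
  · rw [Finset.disjoint_left]
    intro Q hQ hQ'
    obtain ⟨-, -, i, hi, hTi, hij⟩ := mem_contacts.1 hQ'
    exact hij ((mem_own.1 hQ).2.2 i hi hTi)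
  · intro Q hQ
    exact div_pos (h.radius_pos Q (hmem Q hQ)) hp
  · intro Q hQ Q' hQ' hne
    rw [dist_div_scale, ← add_div]
    gcongr
    exact h.separated Q (hmem Q hQ) Q' (hmem Q' hQ') hne
  · intro Q hQ k
    rw [dist_vertex_div_scale]
    gcongr
    exact h.empty Q (hmem Q hQ) j hjN _ ((mem_level_of_pos hj).2 ⟨k, rfl⟩)
  · obtain ⟨e, he⟩ := h.core_nonempty
    have he' : e ∈ level K 0 := by simpa [level] using he
    refine ⟨e / (-1000) ^ j, h.norm_div_scale_le hj he', fun Q hQ => ?_⟩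
    rw [dist_div_scale]
    gcongr
    exact h.empty Q (hmem Q hQ) 0 (Nat.zero_le _) _ he'
  · intro k
    have hk := (mem_level_of_pos (K := K) hj).2 ⟨k, rfl⟩
    obtain ⟨Q, hQ, hd⟩ := h.covered j hjN _ hk
    refine ⟨Q, ?_, by rw [dist_vertex_div_scale, hd]⟩
    by_cases hT : ∀ i ≤ N, Touches K C r Q i → i = j
    · exact Or.inl (mem_own.2 ⟨hQ, ⟨_, hk, hd⟩, hT⟩)
    · push Not at hT
      exact Or.inr (mem_contacts.2 ⟨hQ, ⟨_, hk, hd⟩, hT⟩)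
  · intro Q hQ
    obtain ⟨-, -, i, hi, ⟨x, hx, hd⟩, hij⟩ := mem_contacts.1 hQ
    refine ⟨x / (-1000) ^ j, by rw [dist_div_scale, hd], ?_⟩
    rcases lt_or_gt_of_ne hij with hlt | hlt
    · exact Or.inl (h.norm_div_scale_le hlt hx)
    · exact Or.inr (le_norm_div_scale hlt hx)

open Classical in
/-- The disks touching another level and two points of level `j`. -/
noncomputable def doubleContacts (K : Finset ℂ) (N : ℕ) (𝒬 : Finset ι) (C : ι → ℂ) (r : ι → ℝ)
    (j : ℕ) : Finset ι :=
  (contacts K N 𝒬 C r j).filter fun Q =>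
    (touched (C Q / (-1000) ^ j) (r Q / 1000 ^ j)).card = 2

theorem disjoint_doubleContacts (h : LevelsCover K N 𝒬 C r) {i j : ℕ} (hi : 1 ≤ i) (hij : i < j)
    (hjN : j ≤ N) : Disjoint (doubleContacts K N 𝒬 C r i) (doubleContacts K N 𝒬 C r j) := by
  rw [Finset.disjoint_left]
  intro Q hQi hQj
  obtain ⟨hQi, hci⟩ := Finset.mem_filter.1 hQi
  obtain ⟨hQj, hcj⟩ := Finset.mem_filter.1 hQj
  obtain ⟨hQ, ⟨x, hx, hdx⟩, -⟩ := mem_contacts.1 hQi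
  obtain ⟨-, ⟨y, hy, hdy⟩, -⟩ := mem_contacts.1 hQj
  by_cases hnext : j = i + 1
  · obtain ⟨hni, hpi⟩ := (h.circleCover hi (by omega)).center_pow_of_card (Or.inr hQi) hci
    obtain ⟨hnj, hpj⟩ := (h.circleCover (by omega) hjN).center_pow_of_card (Or.inr hQj) hcj
    have e : C Q / (-1000) ^ i = -1000 * (C Q / (-1000) ^ j) := by
      rw [hnext, pow_succ]; field_simp
    rw [e, mul_pow, hpj, norm_mul] at hpi
    have hn : ‖(-1000 : ℂ)‖ = 1000 := by rw [norm_neg]; norm_num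
    rw [hn] at hpi
    have hne : ((‖C Q / (-1000) ^ j‖ : ℝ) : ℂ) ^ 127 ≠ 0 :=
      pow_ne_zero _ (by exact_mod_cast (norm_pos_iff.2 hnj).ne')
    push_cast at hpi
    rw [mul_pow] at hpi
    have h2 : (2 * 1000 ^ 127 : ℂ) * ((‖C Q / (-1000) ^ j‖ : ℝ) : ℂ) ^ 127 = 0 := by
      have h127 : (-1000 : ℂ) ^ 127 = -1000 ^ 127 := Odd.neg_pow (by decide) _
      rw [h127] at hpi
      linear_combination hpi
    exact hne ((mul_eq_zero.1 h2).resolve_left (by norm_num))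
  · obtain ⟨k, hk⟩ := exists_vertex_lt (z := C Q / (-1000) ^ (i + 1)) (r := r Q / 1000 ^ (i + 1))
      (e := x / (-1000) ^ (i + 1)) (e' := y / (-1000) ^ (i + 1))
      (by rw [dist_div_scale, hdx]) (h.norm_div_scale_le (by omega) hx)
      (by rw [dist_div_scale, hdy]) (le_norm_div_scale (by omega) hy)
    rw [dist_vertex_div_scale] at hk
    have h1 := (div_lt_div_iff_of_pos_right (by positivity)).1 hk
    exact absurd (h.empty Q hQ (i + 1) (by omega) _
      ((mem_level_of_pos (by omega)).2 ⟨k, rfl⟩)) (not_le.2 h1)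

theorem card_ge (h : LevelsCover K N 𝒬 C r) : 64 * N ≤ 𝒬.card := by
  classical
  set I := Finset.Icc 1 N with hI
  set U := I.biUnion (own K N 𝒬 C r) with hU
  set V := I.biUnion (doubleContacts K N 𝒬 C r) with hV
  have hUV : Disjoint U V := by
    rw [Finset.disjoint_left]
    intro Q hQ hQ'
    obtain ⟨i, -, hQi⟩ := Finset.mem_biUnion.1 hQ
    obtain ⟨j, hj, hQj⟩ := Finset.mem_biUnion.1 hQ'
    obtain ⟨-, hTj, k, hk, hTk, hkj⟩ := mem_contacts.1 (Finset.mem_filter.1 hQj).1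
    obtain ⟨-, -, hu⟩ := mem_own.1 hQi
    exact hkj ((hu k hk hTk).trans (hu j (Finset.mem_Icc.1 hj).2 hTj).symm)
  have hcU : U.card = ∑ j ∈ I, (own K N 𝒬 C r j).card := by
    refine Finset.card_biUnion fun i hi j hj hij => Finset.disjoint_left.2 ?_
    intro Q hQi hQj
    exact hij ((mem_own.1 hQj).2.2 i (Finset.mem_Icc.1 (Finset.mem_coe.1 hi)).2 (mem_own.1 hQi).2.1)
  have hcV : V.card = ∑ j ∈ I, (doubleContacts K N 𝒬 C r j).card := by
    refine Finset.card_biUnion fun i hi j hj hij => ?_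
    rw [Finset.mem_coe, hI, Finset.mem_Icc] at hi hj
    rcases lt_or_gt_of_ne hij with hlt | hlt
    · exact h.disjoint_doubleContacts hi.1 hlt hj.2
    · exact (h.disjoint_doubleContacts hj.1 hlt hi.2).symm
  have hsub : U ∪ V ⊆ 𝒬 := by
    refine Finset.union_subset ?_ ?_ <;> refine Finset.biUnion_subset.2 fun j _ Q hQ => ?_
    · exact (mem_own.1 hQ).1
    · exact (mem_contacts.1 (Finset.mem_filter.1 hQ).1).1
  have hle := Finset.card_le_card hsub
  rw [Finset.card_union_of_disjoint hUV, hcU, hcV, ← Finset.sum_add_distrib] at hle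
  refine le_trans ?_ hle
  have hN : I.card = N := by simp [hI]
  rw [mul_comm]
  nth_rewrite 1 [← hN]
  rw [← smul_eq_mul]
  refine Finset.card_nsmul_le_sum _ _ _ fun j hj => ?_
  rw [hI, Finset.mem_Icc] at hj
  have h1 := (h.circleCover hj.1 hj.2).card_ge
  have h2 : (doubleContacts K N 𝒬 C r j).card = ((contacts K N 𝒬 C r j).filter fun Q =>
      (touched (C Q / (-1000) ^ j) (r Q / 1000 ^ j)).card = 2).card := by
    unfold doubleContacts; congr!
  rw [h2]
  omega

end LevelsCover

/-- An isometry between the Euclidean plane and the complex numbers. -/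
noncomputable def planeIsometry : Plane ≃ₗᵢ[ℝ] ℂ := Complex.orthonormalBasisOneI.repr.symm

theorem le_card_of_isDisjointBubbleSet {K : Finset ℂ} (hK : ∀ x ∈ K, ‖x‖ ≤ 1) (hne : K.Nonempty)
    {N : ℕ} {𝒬 : Finset Disk}
    (h : IsDisjointBubbleSet ((levels K N).map planeIsometry.symm.toEquiv.toEmbedding) 𝒬) :
    64 * N ≤ 𝒬.card := by
  have hmem : ∀ j ≤ N, ∀ x ∈ level K j,
      planeIsometry.symm x ∈ (levels K N).map planeIsometry.symm.toEquiv.toEmbedding := by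
    intro j hj x hx
    exact Finset.mem_map_of_mem _ (Finset.mem_biUnion.2 ⟨j, Finset.mem_range.2 (by omega), hx⟩)
  have hdist : ∀ (x : ℂ) (Q : Disk),
      dist x (planeIsometry Q.center) = dist (planeIsometry.symm x) Q.center := by
    intro x Q
    rw [← planeIsometry.dist_map, LinearIsometryEquiv.apply_symm_apply]
  refine LevelsCover.card_ge (K := K) (C := fun Q => planeIsometry Q.center)
    (r := fun Q => Q.radius) ⟨hK, hne, fun Q _ => Q.radius_pos, ?_, ?_, ?_⟩
  · intro Q hQ Q' hQ' hne
    rw [LinearIsometryEquiv.dist_map]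
    exact (disjoint_ball_ball_iff Q.radius_pos Q'.radius_pos).1 (h.disjoint Q hQ Q' hQ' hne)
  · intro Q hQ j hj x hx
    rw [hdist]
    have := h.isEmpty Q hQ _ (hmem j hj x hx)
    exact not_lt.1 this
  · intro j hj x hx
    obtain ⟨Q, hQ, hd⟩ := h.supports _ (hmem j hj x hx)
    exact ⟨Q, hQ, by rw [hdist]; exact hd⟩

theorem exists_core (c : ℕ) : ∃ K : Finset ℂ, K.card = c ∧ ∀ x ∈ K, ‖x‖ ≤ 1 := by
  refine ⟨(Finset.range c).image fun i : ℕ => ((1 / (i + 1) : ℝ) : ℂ), ?_, ?_⟩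
  · rw [Finset.card_image_of_injective, Finset.card_range]
    intro i j hij
    simpa using hij
  · intro x hx
    obtain ⟨i, -, rfl⟩ := Finset.mem_image.1 hx
    rw [Complex.norm_real, Real.norm_of_nonneg (by positivity), div_le_one (by positivity)]
    linarith [(Nat.cast_nonneg i : (0 : ℝ) ≤ i)]

theorem le_disjointBubbleNumber {N c : ℕ} (hc : 1 ≤ c) :
    64 * N ≤ disjointBubbleNumber (c + 127 * N) := by
  obtain ⟨K, hKc, hK⟩ := exists_core c
  have hne : K.Nonempty := Finset.card_pos.1 (by omega)
  set P := (levels K N).map planeIsometry.symm.toEquiv.toEmbedding with hP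
  have hcard : P.card = c + 127 * N := by rw [hP, Finset.card_map, card_levels hK, hKc]
  obtain ⟨𝒬, h𝒬, hk⟩ := (isLeast_disjointBubbleNumberOf P).1
  calc 64 * N ≤ 𝒬.card := le_card_of_isDisjointBubbleSet hK hne h𝒬
    _ = disjointBubbleNumberOf P := hk
    _ ≤ _ := (isGreatest_disjointBubbleNumber _).2 ⟨P, hcard, rfl⟩

theorem theorem4 :
    ∃ C : ℝ, ∀ n : ℕ,
      (1 / 2 + 1 / 257 : ℝ) * (n : ℝ) - C ≤ (disjointBubbleNumber n : ℝ) := by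
  refine ⟨64, fun n => ?_⟩
  rcases Nat.eq_zero_or_pos n with rfl | hn
  · have : (0 : ℝ) ≤ disjointBubbleNumber 0 := Nat.cast_nonneg _
    push_cast
    linarith
  obtain ⟨N, c, hc, hc', rfl⟩ : ∃ N c, 1 ≤ c ∧ c ≤ 127 ∧ n = c + 127 * N :=
    ⟨(n - 1) / 127, (n - 1) % 127 + 1, by omega, by omega, by omega⟩
  have h1 : ((64 * N : ℕ) : ℝ) ≤ disjointBubbleNumber (c + 127 * N) :=
    Nat.cast_le.2 (le_disjointBubbleNumber hc)
  have h2 : (c : ℝ) ≤ 127 := by exact_mod_cast hc'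
  have h3 : (0 : ℝ) ≤ N := Nat.cast_nonneg _
  push_cast at h1 ⊢
  linarith
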